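/- Notation. $\mathfrak M^+$ is the set of non-negative (extended real valued) Lebesgue measurable functions on $(0,\infty)$, and $\mathcal W$ is the set of weights, i.e. of $v\in\mathfrak M^+$ with $0<v<\infty$ almost everywhere; the conventions $0\cdot\infty=0$ and $1/\infty=0$ are used. For $0<p\le\infty$, an interval $I\subseteq(0,\infty)$ and $f,v\in\mathfrak M^+$ put $\|f\|_{p,I}=\big(\int_I f^p\big)^{1/p}$ if $p<\infty$, $\|f\|_{\infty,I}=\operatorname{ess\,sup}_I f$, and $\|f\|_{p,v,I}=\|fv\|_{p,I}$. For $0<p,q\le\infty$ let $$\|f\|_{\mathrm{Ces}_{p,q}(u,v)}=\big\|\,\|f\|_{p,v,(0,\cdot)}\big\|_{q,u,(0,\infty)},\qquad \|f\|_{\mathrm{Cop}_{p,q}(u,v)}=\big\|\,\|f\|_{p,v,(\cdot,\infty)}\big\|_{q,u,(0,\infty)},$$ let $\mathrm{Ces}_{p,q}(u,v)$ and $\mathrm{Cop}_{p,q}(u,v)$ be the sets of $f\in\mathfrak M^+$ for which the respective quantity is finite, and let $\mathrm{Cop}_1(u)=\mathrm{Cop}_{1,1}(u,\mathbf 1)$.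 For such spaces $X,Y$ let $$M(X,Y)=\{f:\ fg\in Y\text{ for all }g\in X\},\qquad \|f\|_{M(X,Y)}=\sup_{g\in X,\ g\not\sim 0}\frac{\|fg\|_Y}{\|g\|_X},$$ where $g\not\sim0$ means that $g$ is not almost everywhere $0$. Let $p'=\frac p{1-p}$ if $0<p<1$ and $p'=\infty$ if $p=1$. Finally let $A_{1,1}(u)(x)=\big(\int_0^x u\big)^{-1}$, $A^*_{q,q}(w)(x)=\big(\int_x^\infty w^q\big)^{1/q}$ and $A^*_{q,1}(w)(x)=\big(\int_x^\infty w^q\big)\,w(x)^{1-q}$. Theorem. Let $0<p\le 1$, $0<q<\infty$ and $q\ne p$. There is a constant $C\in(0,\infty)$ depending only on $p$ and $q$ such that the following holds for every $v\in\mathcal W$, every $u\in\mathfrak M^+$ with $0<\int_0^t u<\infty$ for all $t>0$, and every $w\in\mathfrak M^+$ with $0<\int_t^\infty w^q<\infty$ for all $t>0$. (i) If $q\ge1$, then $$M(\mathrm{Cop}_1(u),\mathrm{Ces}_{p,q}(w,v))=\mathrm{Ces}_{p',\infty}(\omega_1,\omega_2),\qquad \omega_1=A^*_{q,q}(w),\quad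 \omega_2=A_{1,1}(u)\,v.$$ (ii) If $q<1$, then $$M(\mathrm{Cop}_1(u),\mathrm{Ces}_{p,q}(w,v))=\mathrm{Ces}_{p',q'}(\omega_1,\omega_2),\qquad \omega_1=A^*_{q,1}(w),\quad \omega_2=A_{1,1}(u)\,v.$$ In both cases the two sides are equal as sets and their quasi-norms are equivalent: for every $f\in\mathfrak M^+$, $$C^{-1}\,\|f\|_{\mathrm{Ces}}\le\|f\|_{M(\mathrm{Cop}_1(u),\mathrm{Ces}_{p,q}(w,v))}\le C\,\|f\|_{\mathrm{Ces}},$$ where $\|\cdot\|_{\mathrm{Ces}}$ is the quasi-norm of the space on the right-hand side of (i), respectively (ii). -/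

import Mathlib

open MeasureTheory Set Filter
open scoped ENNReal NNReal

noncomputable section

namespace CopCes

/-- Functions on `(0,∞)` are represented by functions on `ℝ`; Lebesgue measure on `(0,∞)`
ignores the values elsewhere. -/
def halfLine : Measure ℝ := volume.restrict (Ioi 0)

/-- The non-negative (extended real valued) Lebesgue measurable functions on `(0,∞)`. -/
def MPlus : Set (ℝ → ℝ≥0∞) := {f | AEMeasurable f halfLine}

/-- Weights on `(0,∞)`: measurable, positive and finite almost everywhere. -/
def Weight : Set (ℝ → ℝ≥0∞) := {v | v ∈ MPlus ∧ ∀ᵐ x ∂halfLine, 0 < v x ∧ v x < ∞}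

/-- `‖f‖_{p,I}`: `(∫_I f ^ p) ^ (1/p)` for `p < ∞`, the essential supremum over `I` for `p = ∞`. -/
def lNorm (p : ℝ≥0∞) (I : Set ℝ) (f : ℝ → ℝ≥0∞) : ℝ≥0∞ := eLpNorm f p (volume.restrict I)

/-- `‖f‖_{p,w,I} = ‖f w‖_{p,I}`. -/
def wLNorm (p : ℝ≥0∞) (w : ℝ → ℝ≥0∞) (I : Set ℝ) (f : ℝ → ℝ≥0∞) : ℝ≥0∞ :=
  lNorm p I (fun x => f x * w x)

/-- The quasi-norm of `Ces_{p,q}(u,v)`. -/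
def cesNorm (p q : ℝ≥0∞) (u v f : ℝ → ℝ≥0∞) : ℝ≥0∞ :=
  wLNorm q u (Ioi 0) (fun x => wLNorm p v (Ioo 0 x) f)

/-- The weighted Cesàro space `Ces_{p,q}(u,v)`. -/
def Ces (p q : ℝ≥0∞) (u v : ℝ → ℝ≥0∞) : Set (ℝ → ℝ≥0∞) :=
  {f | f ∈ MPlus ∧ cesNorm p q u v f < ∞}

/-- The quasi-norm of `Cop_{p,q}(u,v)`. -/
def copNorm (p q : ℝ≥0∞) (u v f : ℝ → ℝ≥0∞) : ℝ≥0∞ :=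
  wLNorm q u (Ioi 0) (fun x => wLNorm p v (Ioi x) f)

/-- The weighted Copson space `Cop_{p,q}(u,v)`. -/
def Cop (p q : ℝ≥0∞) (u v : ℝ → ℝ≥0∞) : Set (ℝ → ℝ≥0∞) :=
  {f | f ∈ MPlus ∧ copNorm p q u v f < ∞}

/-- The class `Ω_q`. -/
def Omega (q : ℝ≥0∞) : Set (ℝ → ℝ≥0∞) :=
  {u | u ∈ MPlus ∧ ∀ t : ℝ, 0 < t → 0 < lNorm q (Ioi t) u ∧ lNorm q (Ioi t) u < ∞}

/-- The class `Ω_q` with a dot: the same requirement on the intervals `(0,t)`. -/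
def OmegaDual (q : ℝ≥0∞) : Set (ℝ → ℝ≥0∞) :=
  {u | u ∈ MPlus ∧ ∀ t : ℝ, 0 < t → 0 < lNorm q (Ioo 0 t) u ∧ lNorm q (Ioo 0 t) u < ∞}

/-- The multipliers from `X` into `Y`. -/
def Mult (X Y : Set (ℝ → ℝ≥0∞)) : Set (ℝ → ℝ≥0∞) :=
  {f | ∀ g ∈ X, (fun x => f x * g x) ∈ Y}

/-- The multiplier quasi-norm: the supremum of `‖f g‖_Y / ‖g‖_X` over `g ∈ X`, `g` not almost
everywhere zero; `NX` and `NY` are the quasi-norms of `X` and of the target space. -/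
def multNorm (X : Set (ℝ → ℝ≥0∞)) (NX NY : (ℝ → ℝ≥0∞) → ℝ≥0∞) (f : ℝ → ℝ≥0∞) : ℝ≥0∞ :=
  ⨆ g ∈ {g | g ∈ X ∧ ¬ g =ᵐ[halfLine] 0}, NY (fun x => f x * g x) / NX g

/-- The conjugate exponent `p'`, also for `p < 1`: `p/(1-p)` if `p < 1`, `∞` if `p = 1`,
`p/(p-1)` if `1 < p < ∞`, and `1` if `p = ∞`. -/
def conjExp (p : ℝ≥0∞) : ℝ≥0∞ :=
  if p < 1 then p / (1 - p) else if p = 1 then ∞ else if p = ∞ then 1 else p / (p - 1)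

/-- `A_{q,p}(u)(x) = (∫_0^x u^q)^{-1/p} u(x)^{(q-p)/p}`. -/
def opA (q p : ℝ) (u : ℝ → ℝ≥0∞) (x : ℝ) : ℝ≥0∞ :=
  (∫⁻ t in Ioo 0 x, u t ^ q) ^ (-(1 / p)) * u x ^ ((q - p) / p)

/-- `A*_{q,p}(u)(x) = (∫_x^∞ u^q)^{1/p} u(x)^{(p-q)/p}`. -/
def opAStar (q p : ℝ) (u : ℝ → ℝ≥0∞) (x : ℝ) : ℝ≥0∞ :=
  (∫⁻ t in Ioi x, u t ^ q) ^ (1 / p) * u x ^ ((p - q) / p)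

end CopCes

end

namespace CopCes


/-! ### Sums with dyadic weights -/

/-! Put `U(t) = ∫_0^t u`. By Tonelli the norm of `g` in `Cop_1(u)` is `∫ g U`, so the substitution
`h = g U` replaces the Copson space by `L¹`. With `F = f v / U` and `dν = w^q dx`, the question
becomes for which `F` one has `∫ (∫_0^x (hF)^p dt)^{q/p} dν(x) ≤ R (∫ h)^q` for all `h`.

Cut the half line into the sets where the tail `ν(x,∞)` lies in `(2^n, 2^{n+1}]`. Let `a_n` be the
integral of `h` and `b_n` the `p'`-norm of `F` over block `n`. Hölder on each block and a dyadic
Hardy inequality bound the left side by a multiple of `∑ 2^n (a_n b_n)^q` (`cesModular_le_tsum`).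
What remains is the boundedness of a diagonal operator from `ℓ¹` to a weighted `ℓ^q`. It is governed
by the supremum of `2^n b_n^q` if `q ≥ 1`, and by the `ℓ^{1/(1-q)}` norm of that sequence if `q <
1`. These quantities match the Cesàro norms of the statement because block `n - 1` lies to the right
of block `n` and, when block `n` is nonempty, carries `ν`-mass at least `2^{n-2}`
(`IsTailMeasure.le_measure_tailBlock`).

For necessity the inequality is tested on near-extremals of Hölder's inequality
(`exists_test_function`), on an interval `(0,x)` or combined over the blocks
(`IsL1Bound.tail_mul_le`, `IsL1Bound.tsum_le`). Equality of the sets also needs a uniform bound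
drawn from mere finiteness; a gliding sum provides it (`exists_isL1Bound`). -/

theorem two_rpow_add (a b : ℝ) : (2 : ℝ≥0∞) ^ (a + b) = 2 ^ a * 2 ^ b :=
  ENNReal.rpow_add _ _ two_ne_zero ENNReal.ofNat_ne_top

theorem two_rpow_ne_zero (a : ℝ) : (2 : ℝ≥0∞) ^ a ≠ 0 :=
  (ENNReal.rpow_pos two_pos ENNReal.ofNat_ne_top).ne'

theorem two_rpow_ne_top (a : ℝ) : (2 : ℝ≥0∞) ^ a ≠ ∞ :=
  ENNReal.rpow_ne_top_of_ne_zero two_ne_zero ENNReal.ofNat_ne_top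

theorem tsum_two_rpow_neg_ne_top {t : ℝ} (ht : 0 < t) :
    ∑' i : ℕ, (2 : ℝ≥0∞) ^ (-(t * i)) ≠ ∞ := by
  have h : ∀ i : ℕ, (2 : ℝ≥0∞) ^ (-(t * i)) = (2 ^ (-t)) ^ i := fun i => by
    rw [← ENNReal.rpow_natCast, ← ENNReal.rpow_mul, neg_mul]
  simp_rw [h, ENNReal.tsum_geometric]
  rw [ENNReal.inv_ne_top]
  refine (tsub_pos_iff_lt.2 ?_).ne'
  rw [ENNReal.rpow_neg, ENNReal.inv_lt_one]
  exact ENNReal.one_lt_rpow ENNReal.one_lt_two ht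

/-- The weight grows geometrically while the inner sum only looks at larger indices. Half of the
exponent `s` makes the inner sum converge, and the other half makes the sum over shifts converge
after the order of summation is exchanged. Each inner term is bounded by the whole weighted sum `M`,
so no case distinction between `r < 1` and `r ≥ 1` arises. -/
theorem tsum_dyadic_hardy {s r : ℝ} (hs : 0 < s) (hr : 0 < r) :
    ∃ C : ℝ≥0, ∀ A : ℤ → ℝ≥0∞,
      ∑' n : ℤ, (2 : ℝ≥0∞) ^ (s * n) * (∑' i : ℕ, A (n + i)) ^ r ≤
        C * ∑' n : ℤ, (2 : ℝ≥0∞) ^ (s * n) * A n ^ r := by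
  set D := ∑' i : ℕ, (2 : ℝ≥0∞) ^ (-(s / (2 * r) * i)) with hD
  have hDt : D ≠ ∞ := tsum_two_rpow_neg_ne_top (by positivity)
  set D' := ∑' i : ℕ, (2 : ℝ≥0∞) ^ (-(s / 2 * i)) with hD'
  have hD't : D' ≠ ∞ := tsum_two_rpow_neg_ne_top (by positivity)
  have hC : D ^ r * D' ≠ ∞ :=
    ENNReal.mul_ne_top (ENNReal.rpow_ne_top_of_nonneg hr.le hDt) hD't
  refine ⟨(D ^ r * D').toNNReal, fun A => ?_⟩
  rw [ENNReal.coe_toNNReal hC]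
  have key : ∀ n : ℤ, (∑' i : ℕ, A (n + i)) ^ r ≤
      D ^ r * ∑' i : ℕ, (2 : ℝ≥0∞) ^ (s / 2 * i) * A (n + i) ^ r := by
    intro n
    set M := ∑' i : ℕ, (2 : ℝ≥0∞) ^ (s / 2 * i) * A (n + i) ^ r with hM
    have h1 : ∀ i : ℕ, A (n + i) ≤ 2 ^ (-(s / (2 * r) * i)) * M ^ (1 / r) := by
      intro i
      have h2 : (2 : ℝ≥0∞) ^ (s / 2 * i) * A (n + i) ^ r ≤ M :=
        ENNReal.le_tsum (f := fun i : ℕ => (2 : ℝ≥0∞) ^ (s / 2 * i) * A (n + i) ^ r) i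
      have h3 := ENNReal.rpow_le_rpow h2 (by positivity : 0 ≤ 1 / r)
      rw [ENNReal.mul_rpow_of_nonneg _ _ (by positivity), ← ENNReal.rpow_mul,
        ← ENNReal.rpow_mul, mul_one_div_cancel hr.ne', ENNReal.rpow_one] at h3
      calc A (n + i) = 2 ^ (-(s / (2 * r) * i)) * (2 ^ (s / 2 * i * (1 / r)) * A (n + i)) := by
            rw [← mul_assoc, ← two_rpow_add]
            have : -(s / (2 * r) * i) + s / 2 * i * (1 / r) = 0 := by field_simp; ring
            rw [this, ENNReal.rpow_zero, one_mul]
        _ ≤ _ := by gcongr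
    have h4 : ∑' i : ℕ, A (n + i) ≤ D * M ^ (1 / r) := by
      rw [hD, ← ENNReal.tsum_mul_right]
      exact ENNReal.tsum_le_tsum h1
    calc _ ≤ (D * M ^ (1 / r)) ^ r := ENNReal.rpow_le_rpow h4 hr.le
      _ = _ := by
        rw [ENNReal.mul_rpow_of_nonneg _ _ hr.le, ← ENNReal.rpow_mul,
          one_div_mul_cancel hr.ne', ENNReal.rpow_one]
  calc ∑' n : ℤ, (2 : ℝ≥0∞) ^ (s * n) * (∑' i : ℕ, A (n + i)) ^ r
      ≤ ∑' n : ℤ, ∑' i : ℕ, D ^ r * (2 ^ (-(s / 2 * i)) *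
          (2 ^ (s * (n + i : ℤ)) * A (n + i) ^ r)) := by
        refine ENNReal.tsum_le_tsum fun n => ?_
        rw [ENNReal.tsum_mul_left]
        calc _ ≤ (2 : ℝ≥0∞) ^ (s * n) * _ := mul_le_mul_right (key n) _
          _ = D ^ r * ((2 : ℝ≥0∞) ^ (s * n) *
              ∑' i : ℕ, (2 : ℝ≥0∞) ^ (s / 2 * i) * A (n + i) ^ r) := by ring
          _ = _ := by
            rw [← ENNReal.tsum_mul_left]
            congr 2
            ext i
            rw [← mul_assoc, ← mul_assoc, ← two_rpow_add, ← two_rpow_add]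
            congr 2
            push_cast
            ring
    _ = D ^ r * ∑' i : ℕ, 2 ^ (-(s / 2 * i)) *
          ∑' n : ℤ, (2 : ℝ≥0∞) ^ (s * (n + i : ℤ)) * A (n + i) ^ r := by
        rw [ENNReal.tsum_comm]
        simp_rw [ENNReal.tsum_mul_left]
    _ = D ^ r * D' * ∑' n : ℤ, (2 : ℝ≥0∞) ^ (s * n) * A n ^ r := by
        have h5 : ∀ i : ℕ, ∑' n : ℤ, (2 : ℝ≥0∞) ^ (s * (n + i : ℤ)) * A (n + i) ^ r =
            ∑' n : ℤ, (2 : ℝ≥0∞) ^ (s * n) * A n ^ r := fun i =>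
          (Equiv.addRight (i : ℤ)).tsum_eq (fun n : ℤ => (2 : ℝ≥0∞) ^ (s * n) * A n ^ r)
        simp_rw [h5, ENNReal.tsum_mul_right]
        rw [mul_assoc]

theorem tsum_rpow_le_rpow_tsum {ι : Type*} {q : ℝ} (hq : 1 ≤ q) (a : ι → ℝ≥0∞) :
    ∑' i, a i ^ q ≤ (∑' i, a i) ^ q := by
  have h : ∀ x : ℝ≥0∞, x ^ q = x * x ^ (q - 1) := fun x => by
    conv_rhs => rw [← ENNReal.rpow_one x, ← ENNReal.rpow_mul, one_mul,
      ← ENNReal.rpow_add_of_nonneg _ _ zero_le_one (by linarith)]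
    congr 1; ring
  rw [h (∑' i, a i), ← ENNReal.tsum_mul_right]
  refine ENNReal.tsum_le_tsum fun i => ?_
  rw [h]
  gcongr
  exact ENNReal.le_tsum i

/-- Hölder for counting measure with exponents `1/q` and `1/(1-q)`. -/
theorem tsum_mul_rpow_le {ι : Type*} [Countable ι] {q : ℝ} (hq : 0 < q) (hq1 : q < 1)
    (a b : ι → ℝ≥0∞) :
    ∑' i, a i ^ q * b i ≤ (∑' i, a i) ^ q * (∑' i, b i ^ (1 / (1 - q))) ^ (1 - q) := by
  let _ : MeasurableSpace ι := ⊤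
  have hc : (1 / q).HolderConjugate (1 / (1 - q)) := by
    rw [Real.holderConjugate_iff]
    refine ⟨by rw [lt_div_iff₀ hq]; linarith, by simp⟩
  have h := ENNReal.lintegral_mul_le_Lp_mul_Lq (Measure.count (α := ι)) hc
    (f := fun i => a i ^ q) (g := b) (measurable_from_top.aemeasurable)
    (measurable_from_top.aemeasurable)
  simp only [lintegral_count, Pi.mul_apply, ← ENNReal.rpow_mul, mul_one_div_cancel hq.ne',
    ENNReal.rpow_one, one_div_one_div] at h
  exact h

/-! ### Tails of a measure on the half line -/

/-- The atomless measures on `(0,∞)` all of whose tails are positive and finite. -/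
structure IsTailMeasure (ν : Measure ℝ) : Prop where
  Iic_zero : ν (Iic 0) = 0
  singleton : ∀ x, ν {x} = 0
  pos : ∀ t, 0 < t → 0 < ν (Ioi t)
  lt_top : ∀ t, 0 < t → ν (Ioi t) < ∞

theorem antitone_tail (ν : Measure ℝ) : Antitone fun t => ν (Ioi t) :=
  fun _ _ h => measure_mono (Ioi_subset_Ioi h)

theorem measurable_tail (ν : Measure ℝ) : Measurable fun t => ν (Ioi t) :=
  (antitone_tail ν).measurable

/-- Right continuity of the tail, that is, continuity of `ν` from below. -/
theorem tail_sInf_le {ν : Measure ℝ} {A : Set ℝ} (hA : A.Nonempty) (hA0 : BddBelow A)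
    {s : ℝ≥0∞} (h : ∀ x ∈ A, ν (Ioi x) ≤ s) : ν (Ioi (sInf A)) ≤ s := by
  obtain ⟨u, hu, hlt, hlim⟩ := exists_seq_strictAnti_tendsto (sInf A)
  have hU : Ioi (sInf A) = ⋃ n, Ioi (u n) := by
    ext y
    simp only [mem_Ioi, mem_iUnion]
    exact ⟨fun hy => (hlim.eventually_lt_const hy).exists, fun ⟨n, hn⟩ => (hlt n).trans hn⟩
  have hm : Monotone fun n => Ioi (u n) := fun _ _ hij => Ioi_subset_Ioi (hu.antitone hij)
  rw [hU, hm.measure_iUnion]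
  refine iSup_le fun n => ?_
  obtain ⟨x, hx, hxn⟩ := (csInf_lt_iff hA0 hA).1 (hlt n)
  exact (antitone_tail ν hxn.le).trans (h x hx)

namespace IsTailMeasure

variable {ν : Measure ℝ}

theorem measure_le (hν : IsTailMeasure ν) {A : Set ℝ} (hA0 : BddBelow A) {s : ℝ≥0∞}
    (h : ∀ x ∈ A, ν (Ioi x) ≤ s) : ν A ≤ s := by
  rcases A.eq_empty_or_nonempty with rfl | hA
  · simp
  calc ν A ≤ ν ({sInf A} ∪ Ioi (sInf A)) := measure_mono fun x hx => by
        rcases (csInf_le hA0 hx).eq_or_lt with h | h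
        · exact Or.inl h.symm
        · exact Or.inr h
    _ ≤ ν {sInf A} + ν (Ioi (sInf A)) := measure_union_le _ _
    _ ≤ s := by rw [hν.singleton, zero_add]; exact tail_sInf_le hA hA0 h

theorem exists_tail_le (hν : IsTailMeasure ν) {s : ℝ≥0∞} (hs : 0 < s) :
    ∃ x, 0 < x ∧ ν (Ioi x) ≤ s := by
  have hm : Antitone fun n : ℕ => Ioi ((n : ℝ) + 1) := fun i j hij =>
    Ioi_subset_Ioi (by simpa using hij)
  have h := hm.measure_iInter (μ := ν) (fun i => measurableSet_Ioi.nullMeasurableSet)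
    ⟨0, (hν.lt_top _ (by positivity)).ne⟩
  have h0 : ⋂ n : ℕ, Ioi ((n : ℝ) + 1) = ∅ := by
    refine eq_empty_of_forall_notMem fun x hx => ?_
    obtain ⟨n, hn⟩ := exists_nat_gt x
    have := mem_iInter.1 hx n
    simp only [mem_Ioi] at this
    linarith
  rw [h0, measure_empty] at h
  obtain ⟨n, hn⟩ := iInf_lt_iff.1 (h ▸ hs)
  exact ⟨n + 1, by positivity, hn.le⟩

/-- An intermediate value theorem. At the infimum of the points where the tail is at most `s`, right
continuity gives `≤`; left continuity, which uses finite tails and the absence of atoms, gives `≥`.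
-/
theorem exists_tail_eq (hν : IsTailMeasure ν) {s : ℝ≥0∞} (hs : 0 < s) {x : ℝ} (hx : 0 < x)
    (hsx : s < ν (Ioi x)) : ∃ y, 0 < y ∧ ν (Ioi y) = s := by
  set A := {y : ℝ | 0 < y ∧ ν (Ioi y) ≤ s} with hA
  have hne : A.Nonempty := hν.exists_tail_le hs
  have hb : ∀ y ∈ A, x ≤ y := fun y hy => by
    by_contra! h
    exact (hsx.trans_le (antitone_tail ν h.le)).not_ge hy.2
  have hbdd : BddBelow A := ⟨x, hb⟩
  have hxa : x ≤ sInf A := le_csInf hne hb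
  refine ⟨sInf A, hx.trans_le hxa, le_antisymm (tail_sInf_le hne hbdd fun y hy => hy.2) ?_⟩
  obtain ⟨u, hu, hlt, hlim⟩ := exists_seq_strictMono_tendsto' (hx.trans_le hxa)
  have hm : Antitone fun n => Ioi (u n) := fun _ _ hij => Ioi_subset_Ioi (hu.monotone hij)
  have hI : ⋂ n, Ioi (u n) = Ici (sInf A) := by
    ext y
    simp only [mem_Ioi, mem_iInter, mem_Ici]
    exact ⟨fun h => ge_of_tendsto' hlim.neg (fun n => neg_le_neg (h n).le) |> neg_le_neg_iff.1,
      fun h n => (hlt n).2.trans_le h⟩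
  have h := hm.measure_iInter (μ := ν) (fun i => measurableSet_Ioi.nullMeasurableSet)
    ⟨0, (hν.lt_top _ (hlt 0).1).ne⟩
  have hc : ν (Ici (sInf A)) ≤ ν (Ioi (sInf A)) := by
    rw [← Ioi_union_left]
    exact (measure_union_le _ _).trans (by rw [hν.singleton, add_zero])
  refine le_trans ?_ hc
  rw [← hI, h]
  refine le_iInf fun n => ?_
  by_contra! hn
  exact (csInf_le hbdd ⟨(hlt n).1, hn.le⟩).not_gt (hlt n).2

end IsTailMeasure

/-- The dyadic level sets of the tail function of `ν`. -/
def tailBlock (ν : Measure ℝ) (n : ℤ) : Set ℝ :=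
  {x | 0 < x ∧ 2 ^ (n : ℝ) < ν (Ioi x) ∧ ν (Ioi x) ≤ 2 ^ ((n : ℝ) + 1)}

theorem tailBlock_subset (ν : Measure ℝ) (n : ℤ) : tailBlock ν n ⊆ Ioi 0 := fun _ hx => hx.1

theorem measurableSet_tailBlock (ν : Measure ℝ) (n : ℤ) : MeasurableSet (tailBlock ν n) :=
  measurableSet_Ioi.inter (measurable_tail ν measurableSet_Ioc)

/-- Tails decrease, so the blocks are ordered in reverse: a larger index lies nearer to `0`. -/
theorem lt_of_mem_tailBlock {ν : Measure ℝ} {m n : ℤ} (h : n < m) {x y : ℝ}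
    (hx : x ∈ tailBlock ν m) (hy : y ∈ tailBlock ν n) : x < y := by
  by_contra! hyx
  have h1 : ν (Ioi x) ≤ ν (Ioi y) := antitone_tail ν hyx
  have h2 : (2 : ℝ≥0∞) ^ ((n : ℝ) + 1) ≤ 2 ^ (m : ℝ) :=
    ENNReal.rpow_le_rpow_of_exponent_le one_le_two (by exact_mod_cast h)
  exact ((h1.trans hy.2.2).trans h2).not_gt hx.2.1

theorem disjoint_tailBlock (ν : Measure ℝ) : Pairwise (Function.onFun Disjoint (tailBlock ν)) := by
  intro m n hmn
  refine disjoint_left.2 fun x hx hy => ?_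
  rcases hmn.lt_or_gt with h | h
  · exact (lt_of_mem_tailBlock h hy hx).false
  · exact (lt_of_mem_tailBlock h hx hy).false

namespace IsTailMeasure

variable {ν : Measure ℝ}

theorem iUnion_tailBlock (hν : IsTailMeasure ν) : ⋃ n, tailBlock ν n = Ioi 0 := by
  refine Subset.antisymm (iUnion_subset (tailBlock_subset ν)) fun x hx => ?_
  obtain ⟨n, hn⟩ := ENNReal.exists_mem_Ioc_zpow (hν.pos x hx).ne' (hν.lt_top x hx).ne
    ENNReal.one_lt_two ENNReal.ofNat_ne_top
  refine mem_iUnion.2 ⟨n, hx, ?_, ?_⟩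
  · rw [ENNReal.rpow_intCast]; exact hn.1
  · have := hn.2
    rw [← ENNReal.rpow_intCast] at this
    push_cast at this
    exact this

theorem Ioo_subset_iUnion (hν : IsTailMeasure ν) {n : ℤ} {x : ℝ} (hx : x ∈ tailBlock ν n) :
    Ioo 0 x ⊆ ⋃ i : ℕ, tailBlock ν (n + i) := by
  intro y hy
  obtain ⟨m, hm⟩ := mem_iUnion.1 (hν.iUnion_tailBlock.ge hy.1)
  have hmn : n ≤ m := by
    by_contra! h
    exact (lt_of_mem_tailBlock h hx hm).not_gt hy.2
  obtain ⟨i, rfl⟩ := Int.le.dest hmn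
  exact mem_iUnion.2 ⟨i, hm⟩

theorem measure_tailBlock_le (hν : IsTailMeasure ν) (n : ℤ) :
    ν (tailBlock ν n) ≤ 2 ^ ((n : ℝ) + 1) :=
  hν.measure_le ⟨0, fun _ hx => hx.1.le⟩ fun _ hx => hx.2.2

/-- Blocks may be empty when `ν` has finite total mass. Once the tail exceeds `2^n` somewhere,
however, it takes every smaller positive value, so it sweeps through the whole range of block `n -
1`. -/
theorem le_measure_tailBlock (hν : IsTailMeasure ν) {n : ℤ} (hn : (tailBlock ν n).Nonempty) :
    2 ^ ((n : ℝ) - 2) ≤ ν (tailBlock ν (n - 1)) := by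
  obtain ⟨x, hx0, hx, -⟩ := hn
  set s : ℝ≥0∞ := 2 ^ ((n : ℝ) - 2) with hs
  have hs0 : s ≠ 0 := two_rpow_ne_zero _
  have hst : s ≠ ∞ := two_rpow_ne_top _
  have e1 : (2 : ℝ≥0∞) ^ ((n : ℝ) - 1) = 2 * s := by
    rw [show (n : ℝ) - 1 = 1 + (n - 2) by ring, two_rpow_add, ENNReal.rpow_one]
  have e0 : (2 : ℝ≥0∞) ^ (n : ℝ) = 4 * s := by
    rw [show (n : ℝ) = 2 + (n - 2) by ring, two_rpow_add, hs]
    norm_num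
  -- In units of `s`, block `n - 1` is where the tail lies in `(2s, 4s]`. Stopping at `3s` respects
  -- the strict lower bound and still leaves mass `s`.
  obtain ⟨y, hy0, hy⟩ := hν.exists_tail_eq (s := 4 * s) (by positivity) hx0 (e0 ▸ hx)
  have h34 : 3 * s < 4 * s :=
    ENNReal.mul_lt_mul_left hs0 hst (by norm_num)
  obtain ⟨z, hz0, hz⟩ := hν.exists_tail_eq (s := 3 * s) (by positivity) hy0 (hy ▸ h34)
  have hyz : y < z := by
    by_contra! h
    have : ν (Ioi y) ≤ ν (Ioi z) := antitone_tail ν h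
    rw [hy, hz] at this
    exact this.not_gt h34
  have hsub : Ioc y z ⊆ tailBlock ν (n - 1) := by
    intro t ht
    have h1 : ν (Ioi t) ≤ ν (Ioi y) := antitone_tail ν ht.1.le
    have h2 : ν (Ioi z) ≤ ν (Ioi t) := antitone_tail ν ht.2
    refine ⟨hy0.trans ht.1, ?_, ?_⟩
    · push_cast
      rw [e1]
      refine lt_of_lt_of_le ?_ (hz ▸ h2)
      exact ENNReal.mul_lt_mul_left hs0 hst (by norm_num)
    · push_cast
      rw [sub_add_cancel, e0, ← hy]
      exact h1
  refine le_trans ?_ (measure_mono hsub)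
  have hd : ν (Ioi y) ≤ ν (Ioc y z) + ν (Ioi z) := by
    rw [← Ioc_union_Ioi_eq_Ioi hyz.le]
    exact measure_union_le _ _
  rw [hy, hz] at hd
  have h3 : 3 * s ≠ ∞ := ENNReal.mul_ne_top (by norm_num) hst
  refine (ENNReal.add_le_add_iff_right h3).1 (le_trans (le_of_eq ?_) hd)
  ring

end IsTailMeasure


/-! ### Conjugate exponents and local norms -/

theorem conjExp_ofReal_of_lt_one {p : ℝ} (hp : 0 < p) (hp1 : p < 1) :
    conjExp (ENNReal.ofReal p) = ENNReal.ofReal (p / (1 - p)) := by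
  have h : ENNReal.ofReal p < 1 := by simpa using hp1
  rw [conjExp, if_pos h, ENNReal.ofReal_div_of_pos (by linarith),
    ENNReal.ofReal_sub 1 hp.le, ENNReal.ofReal_one]

theorem conjExp_one : conjExp (ENNReal.ofReal 1) = ∞ := by
  simp [conjExp]

theorem lNorm_ofReal {s : ℝ} (hs : 0 < s) (E : Set ℝ) (f : ℝ → ℝ≥0∞) :
    lNorm (ENNReal.ofReal s) E f = (∫⁻ x in E, f x ^ s) ^ (1 / s) := by
  rw [lNorm, eLpNorm_eq_lintegral_rpow_enorm_toReal (by simpa using hs) ENNReal.ofReal_ne_top,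
    ENNReal.toReal_ofReal hs.le]
  rfl

theorem lNorm_top (E : Set ℝ) (f : ℝ → ℝ≥0∞) :
    lNorm ∞ E f = essSup f (volume.restrict E) := by
  rw [lNorm, eLpNorm_exponent_top]
  rfl

theorem lNorm_mono_set (s : ℝ≥0∞) (f : ℝ → ℝ≥0∞) {E E' : Set ℝ} (h : E ⊆ E') :
    lNorm s E f ≤ lNorm s E' f :=
  eLpNorm_mono_measure _ (Measure.restrict_mono h le_rfl)

theorem setLIntegral_mul_rpow_le {p : ℝ} (hp : 0 < p) (hp1 : p ≤ 1) {E : Set ℝ}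
    {h F : ℝ → ℝ≥0∞} (hh : AEMeasurable h (volume.restrict E))
    (hF : AEMeasurable F (volume.restrict E)) :
    ∫⁻ x in E, (h x * F x) ^ p ≤
      ((∫⁻ x in E, h x) * lNorm (conjExp (ENNReal.ofReal p)) E F) ^ p := by
  rcases hp1.lt_or_eq with hp1 | rfl
  · have h1p : 0 < 1 - p := by linarith
    have hc : (1 / p).HolderConjugate (1 / (1 - p)) := by
      rw [Real.holderConjugate_iff]
      exact ⟨by rw [lt_div_iff₀ hp]; linarith, by simp⟩
    have key := ENNReal.lintegral_mul_le_Lp_mul_Lq _ hc (hh.pow_const p) (hF.pow_const p)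
    simp only [Pi.mul_apply, ← ENNReal.rpow_mul, mul_one_div_cancel hp.ne',
      ENNReal.rpow_one, one_div_one_div] at key
    rw [conjExp_ofReal_of_lt_one hp hp1, lNorm_ofReal (by positivity),
      ENNReal.mul_rpow_of_nonneg _ _ hp.le, ← ENNReal.rpow_mul]
    have e : 1 / (p / (1 - p)) * p = 1 - p := by field_simp
    rw [e]
    simp_rw [ENNReal.mul_rpow_of_nonneg _ _ hp.le]
    simpa only [mul_one_div] using key
  · rw [conjExp_one, lNorm_top, ENNReal.rpow_one]
    simp_rw [ENNReal.rpow_one]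
    rw [← lintegral_mul_const'' _ hh]
    refine lintegral_mono_ae ?_
    filter_upwards [ENNReal.ae_le_essSup F] with x hx
    gcongr

/-- The power of the `p'`-norm over a set which is countably subadditive in the set. -/
noncomputable def conjPow (p : ℝ) : ℝ := if p < 1 then p / (1 - p) else 1

theorem conjPow_pos {p : ℝ} (hp : 0 < p) : 0 < conjPow p := by
  unfold conjPow
  split_ifs with h
  · exact div_pos hp (by linarith)
  · exact one_pos

/-- For `p < 1` this power of the norm is an integral over the set; for `p = 1` a supremum is at
most the sum of the suprema. -/
theorem lNorm_conjExp_iUnion_le {p : ℝ} (hp : 0 < p) (hp1 : p ≤ 1) {ι : Type*} [Countable ι]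
    (E : ι → Set ℝ) (F : ℝ → ℝ≥0∞) :
    lNorm (conjExp (ENNReal.ofReal p)) (⋃ i, E i) F ^ conjPow p ≤
      ∑' i, lNorm (conjExp (ENNReal.ofReal p)) (E i) F ^ conjPow p := by
  rcases hp1.lt_or_eq with hp1 | rfl
  · have hs : 0 < p / (1 - p) := div_pos hp (by linarith)
    simp only [conjExp_ofReal_of_lt_one hp hp1, lNorm_ofReal hs, conjPow, if_pos hp1,
      ← ENNReal.rpow_mul, one_div_mul_cancel hs.ne', ENNReal.rpow_one]
    exact lintegral_iUnion_le _ _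
  · simp only [conjExp_one, lNorm_top, conjPow, lt_irrefl, if_false, ENNReal.rpow_one]
    refine essSup_le_of_ae_le _ ?_
    refine (ae_restrict_iUnion_iff _ _).2 fun i => ?_
    filter_upwards [ENNReal.ae_le_essSup (μ := volume.restrict (E i)) F] with x hx
    exact hx.trans (ENNReal.le_tsum (f := fun i => essSup F (volume.restrict (E i))) i)

theorem exists_measurable_le_lt_lintegral {α : Type*} [MeasurableSpace α] {μ : Measure α}
    [SigmaFinite μ] {f : α → ℝ≥0∞} {c : ℝ≥0∞} (hc : c < ∫⁻ x, f x ∂μ) :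
    ∃ g : α → ℝ≥0∞, Measurable g ∧ (∀ x, g x ≤ f x) ∧ c < ∫⁻ x, g x ∂μ ∧ ∫⁻ x, g x ∂μ < ∞ := by
  rw [lintegral_eq_nnreal] at hc
  obtain ⟨φ, hφ⟩ := lt_iSup_iff.1 hc
  obtain ⟨hφf, hφ⟩ := lt_iSup_iff.1 hφ
  rw [← SimpleFunc.lintegral_eq_lintegral] at hφ
  obtain ⟨g, hg, hgt, hcg⟩ := SimpleFunc.exists_lt_lintegral_simpleFunc_of_lt_lintegral hφ
  exact ⟨fun x => g x, g.measurable.coe_nnreal_ennreal,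
    fun x => (ENNReal.coe_le_coe.2 (hg x)).trans (hφf x), hcg, hgt⟩

/-- Converse of Hölder. For `p < 1` the equality case is `h` proportional to `F^{p'}`; a minorant
`g` of finite integral replaces `F^{p'}` so that it can be normalised. For `p = 1`, mass one is
spread over a set of finite measure where `F > c`. -/
theorem exists_test_function {p : ℝ} (hp : 0 < p) (hp1 : p ≤ 1) {E : Set ℝ}
    (hE : MeasurableSet E) {F : ℝ → ℝ≥0∞} {c : ℝ≥0∞}
    (hF : AEMeasurable F (volume.restrict E))
    (hc : c < lNorm (conjExp (ENNReal.ofReal p)) E F) :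
    ∃ h : ℝ → ℝ≥0∞, Measurable h ∧ (∀ x ∉ E, h x = 0) ∧ ∫⁻ x, h x ≤ 1 ∧
      c ^ p ≤ ∫⁻ x in E, (h x * F x) ^ p := by
  rcases hp1.lt_or_eq with hp1 | rfl
  · have h1p : 0 < 1 - p := by linarith
    set s := p / (1 - p) with hs_def
    have hs : 0 < s := by positivity
    rw [conjExp_ofReal_of_lt_one hp hp1, lNorm_ofReal hs] at hc
    have hc' : c ^ s < ∫⁻ x in E, F x ^ s := by
      have := ENNReal.rpow_lt_rpow hc hs
      rwa [← ENNReal.rpow_mul, one_div_mul_cancel hs.ne', ENNReal.rpow_one] at this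
    obtain ⟨g, hgm, hgF, hcg, hgt⟩ := exists_measurable_le_lt_lintegral hc'
    set I := ∫⁻ x in E, g x with hI
    have hI0 : I ≠ 0 := (zero_le.trans_lt hcg).ne'
    have hIi : I⁻¹ ≠ ∞ := ENNReal.inv_ne_top.2 hI0
    refine ⟨E.indicator fun x => I⁻¹ * g x, (hgm.const_mul _).indicator hE,
      fun x hx => indicator_of_notMem hx _, ?_, ?_⟩
    · rw [lintegral_indicator hE, lintegral_const_mul _ hgm, ← hI,
        ENNReal.inv_mul_cancel hI0 hgt.ne]
    · calc c ^ p = (c ^ s) ^ (1 - p) := by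
            rw [← ENNReal.rpow_mul, hs_def, div_mul_cancel₀ _ h1p.ne']
        _ ≤ I ^ (1 - p) := ENNReal.rpow_le_rpow hcg.le h1p.le
        _ = I⁻¹ ^ p * I := by
            rw [ENNReal.inv_rpow, ← ENNReal.rpow_neg, sub_eq_neg_add, ENNReal.rpow_add _ _ hI0 hgt.ne,
              ENNReal.rpow_one]
        _ = ∫⁻ x in E, I⁻¹ ^ p * g x := by rw [lintegral_const_mul _ hgm]
        _ ≤ _ := by
            refine setLIntegral_mono' hE fun x hx => ?_
            rw [indicator_of_mem hx, mul_assoc, ENNReal.mul_rpow_of_nonneg _ _ hp.le]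
            gcongr
            have h1 : g x ^ (1 / s) ≤ F x := by
              have := ENNReal.rpow_le_rpow (hgF x) (by positivity : 0 ≤ 1 / s)
              rwa [← ENNReal.rpow_mul, mul_one_div_cancel hs.ne', ENNReal.rpow_one] at this
            calc g x = (g x * g x ^ (1 / s)) ^ p := by
                  nth_rewrite 2 [← ENNReal.rpow_one (g x)]
                  rw [← ENNReal.rpow_add_of_nonneg _ _ zero_le_one (by positivity),
                    ← ENNReal.rpow_mul]
                  have : (1 + 1 / s) * p = 1 := by rw [hs_def]; field_simp; ring
                  rw [this, ENNReal.rpow_one]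
              _ ≤ _ := ENNReal.rpow_le_rpow (by gcongr) hp.le
  · rw [conjExp_one, lNorm_top] at hc
    -- `F` is only almost everywhere measurable, so the superlevel set is that of its measurable
    -- representative.
    have hpos : volume.restrict E {x | c < hF.mk F x} ≠ 0 := fun h0 => by
      refine hc.not_ge (essSup_le_of_ae_le _ ?_)
      have h0' : ∀ᵐ x ∂volume.restrict E, ¬ c < hF.mk F x := measure_eq_zero_iff_ae_notMem.1 h0
      filter_upwards [h0', hF.ae_eq_mk] with x hx hx'
      rw [hx']
      exact not_lt.1 hx
    have hm : MeasurableSet {x | c < hF.mk F x} := measurableSet_lt measurable_const hF.measurable_mk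
    rw [Measure.restrict_apply hm] at hpos
    obtain ⟨S, hSm, hSE, hS0, hSt⟩ :=
      Measure.exists_subset_measure_lt_top (hm.inter hE) (pos_iff_ne_zero.2 hpos)
    refine ⟨S.indicator fun _ => (volume S)⁻¹, measurable_const.indicator hSm,
      fun x hx => indicator_of_notMem (fun h => hx (hSE h).2) _, ?_, ?_⟩
    · rw [lintegral_indicator hSm, setLIntegral_const, ENNReal.inv_mul_cancel hS0.ne' hSt.ne]
    · simp_rw [ENNReal.rpow_one]
      calc c = ∫⁻ x in S, (volume S)⁻¹ * c := by
            rw [setLIntegral_const, mul_right_comm, ENNReal.inv_mul_cancel hS0.ne' hSt.ne, one_mul]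
        _ ≤ ∫⁻ x in S, S.indicator (fun _ => (volume S)⁻¹) x * F x := by
            have hae : F =ᵐ[volume.restrict S] hF.mk F :=
              ae_mono (Measure.restrict_mono (fun x hx => (hSE hx).2) le_rfl) hF.ae_eq_mk
            refine lintegral_mono_ae ?_
            filter_upwards [hae, ae_restrict_mem hSm] with x hx hxS
            rw [indicator_of_mem hxS, hx]
            gcongr
            exact (hSE hxS).1.le
        _ ≤ _ := lintegral_mono_set fun x hx => (hSE hx).2


/-! ### The reduced inequality on the half line -/

/-- The `q`-th power of the quasi-norm of `φ` in `Ces_{p,q}` with respect to the outer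
measure `ν`. -/
noncomputable def cesModular (p q : ℝ) (ν : Measure ℝ) (φ : ℝ → ℝ≥0∞) : ℝ≥0∞ :=
  ∫⁻ x, (∫⁻ t in Ioo 0 x, φ t ^ p) ^ (q / p) ∂ν

theorem IsTailMeasure.lintegral_eq_tsum {ν : Measure ℝ} (hν : IsTailMeasure ν)
    (f : ℝ → ℝ≥0∞) : ∫⁻ x, f x ∂ν = ∑' n, ∫⁻ x in tailBlock ν n, f x ∂ν := by
  rw [← lintegral_iUnion (measurableSet_tailBlock ν) (disjoint_tailBlock ν), hν.iUnion_tailBlock,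
    Measure.restrict_eq_self_of_ae_mem]
  filter_upwards [measure_eq_zero_iff_ae_notMem.1 hν.Iic_zero] with x hx
  simpa using hx

/-- The shift pairs block `n`, where `F` is measured, with block `n - 1` to its right, where `ν` is
integrated. -/
theorem IsTailMeasure.lintegral_eq_tsum_sub_one {ν : Measure ℝ} (hν : IsTailMeasure ν)
    (f : ℝ → ℝ≥0∞) : ∫⁻ x, f x ∂ν = ∑' n : ℤ, ∫⁻ x in tailBlock ν (n - 1), f x ∂ν := by
  rw [hν.lintegral_eq_tsum]
  exact ((Equiv.subRight (1 : ℤ)).tsum_eq (fun n => ∫⁻ x in tailBlock ν n, f x ∂ν)).symm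

theorem IsTailMeasure.setLIntegral_Ioi_eq_tsum {ν : Measure ℝ} (hν : IsTailMeasure ν)
    (f : ℝ → ℝ≥0∞) : ∫⁻ x in Ioi 0, f x = ∑' n, ∫⁻ x in tailBlock ν n, f x := by
  rw [← lintegral_iUnion (measurableSet_tailBlock ν) (disjoint_tailBlock ν), hν.iUnion_tailBlock]

theorem mul_measure_le_setLIntegral {α : Type*} [MeasurableSpace α] {μ : Measure α} {E : Set α}
    (hE : MeasurableSet E) {c : ℝ≥0∞} {f : α → ℝ≥0∞} (h : ∀ x ∈ E, c ≤ f x) :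
    c * μ E ≤ ∫⁻ x in E, f x ∂μ := by
  rw [← setLIntegral_const]
  exact setLIntegral_mono' hE h

theorem setLIntegral_le_mul_measure {α : Type*} [MeasurableSpace α] {μ : Measure α} {E : Set α}
    (hE : MeasurableSet E) {c : ℝ≥0∞} {f : α → ℝ≥0∞} (h : ∀ x ∈ E, f x ≤ c) :
    ∫⁻ x in E, f x ∂μ ≤ c * μ E := by
  rw [← setLIntegral_const]
  exact setLIntegral_mono' hE h

theorem lNorm_empty (s : ℝ≥0∞) (F : ℝ → ℝ≥0∞) : lNorm s ∅ F = 0 := by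
  simp [lNorm]

theorem tailBlock_subset_Ioo {ν : Measure ℝ} {n : ℤ} {x : ℝ} (hx : x ∈ tailBlock ν (n - 1)) :
    tailBlock ν n ⊆ Ioo 0 x :=
  fun _ hy => ⟨hy.1, lt_of_mem_tailBlock (by omega) hy hx⟩

/-- For `x` in block `n` the interval `(0,x)` is covered by the blocks of index at least `n`, and
`ν` of the block is at most `2^{n+1}`. The Hardy inequality then removes the inner sum and Hölder
separates `h` from `F`. -/
theorem cesModular_le_tsum {p q : ℝ} (hp : 0 < p) (hp1 : p ≤ 1) (hq : 0 < q) :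
    ∃ C : ℝ≥0, ∀ ν, IsTailMeasure ν → ∀ h F : ℝ → ℝ≥0∞,
      AEMeasurable h (volume.restrict (Ioi 0)) → AEMeasurable F (volume.restrict (Ioi 0)) →
      cesModular p q ν (fun x => h x * F x) ≤
        C * ∑' n : ℤ, (2 : ℝ≥0∞) ^ (n : ℝ) * ((∫⁻ x in tailBlock ν n, h x) *
          lNorm (conjExp (ENNReal.ofReal p)) (tailBlock ν n) F) ^ q := by
  obtain ⟨C, hC⟩ := tsum_dyadic_hardy (one_pos) (div_pos hq hp)
  refine ⟨2 * C, fun ν hν h F hh hF => ?_⟩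
  set A : ℤ → ℝ≥0∞ := fun n => ∫⁻ t in tailBlock ν n, (h t * F t) ^ p with hA
  have hAle : ∀ n, A n ^ (q / p) ≤ ((∫⁻ x in tailBlock ν n, h x) *
      lNorm (conjExp (ENNReal.ofReal p)) (tailBlock ν n) F) ^ q := fun n => by
    have hr := Measure.restrict_mono (μ := volume) (tailBlock_subset ν n) le_rfl
    have := ENNReal.rpow_le_rpow
      (setLIntegral_mul_rpow_le hp hp1 (hh.mono_measure hr) (hF.mono_measure hr))
      (by positivity : 0 ≤ q / p)
    rwa [← ENNReal.rpow_mul, mul_div_cancel₀ _ hp.ne'] at this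
  calc cesModular p q ν (fun x => h x * F x)
      ≤ ∑' n : ℤ, (2 : ℝ≥0∞) * (2 ^ ((1 : ℝ) * n) * (∑' i : ℕ, A (n + i)) ^ (q / p)) := by
        rw [cesModular, hν.lintegral_eq_tsum]
        refine ENNReal.tsum_le_tsum fun n => ?_
        refine (setLIntegral_le_mul_measure (measurableSet_tailBlock ν n)
          (c := (∑' i : ℕ, A (n + i)) ^ (q / p)) fun x hx => ?_).trans ?_
        · refine ENNReal.rpow_le_rpow ?_ (by positivity)
          exact (lintegral_mono_set (hν.Ioo_subset_iUnion hx)).trans (lintegral_iUnion_le _ _)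
        · rw [mul_comm, ← mul_assoc]
          gcongr
          refine (hν.measure_tailBlock_le n).trans (le_of_eq ?_)
          rw [two_rpow_add, ENNReal.rpow_one, one_mul, mul_comm]
    _ ≤ 2 * (C * ∑' n : ℤ, (2 : ℝ≥0∞) ^ ((1 : ℝ) * n) * A n ^ (q / p)) := by
        rw [ENNReal.tsum_mul_left]
        gcongr
        exact hC A
    _ ≤ _ := by
        push_cast
        simp_rw [one_mul]
        rw [mul_assoc]
        gcongr with n
        exact hAle n

theorem cesModular_le_of_one_le {p q : ℝ} (hp : 0 < p) (hp1 : p ≤ 1) (hq : 1 ≤ q) :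
    ∃ C : ℝ≥0, ∀ ν, IsTailMeasure ν → ∀ h F : ℝ → ℝ≥0∞,
      AEMeasurable h (volume.restrict (Ioi 0)) → AEMeasurable F (volume.restrict (Ioi 0)) →
      ∀ B : ℝ≥0∞, (∀ᵐ x ∂ν, lNorm (conjExp (ENNReal.ofReal p)) (Ioo 0 x) F *
        ν (Ioi x) ^ (1 / q) ≤ B) →
      cesModular p q ν (fun x => h x * F x) ≤ C * (B * ∫⁻ x in Ioi 0, h x) ^ q := by
  have hq0 : 0 < q := by linarith
  obtain ⟨C, hC⟩ := cesModular_le_tsum hp hp1 hq0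
  refine ⟨C * 2, fun ν hν h F hh hF B hB => (hC ν hν h F hh hF).trans ?_⟩
  have key : ∀ n : ℤ, (2 : ℝ≥0∞) ^ (n : ℝ) *
      lNorm (conjExp (ENNReal.ofReal p)) (tailBlock ν n) F ^ q ≤ 2 * B ^ q := by
    intro n
    rcases (tailBlock ν n).eq_empty_or_nonempty with he | hne
    · rw [he, lNorm_empty, ENNReal.zero_rpow_of_pos hq0, mul_zero]
      exact zero_le
    -- Positive mass of block `n - 1` yields a point satisfying the almost everywhere bound. The
    -- tail there exceeds `2^{n-1}`, hence the factor `2`.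
    have hpos : ν (tailBlock ν (n - 1)) ≠ 0 :=
      ((pos_iff_ne_zero.2 (two_rpow_ne_zero _)).trans_le (hν.le_measure_tailBlock hne)).ne'
    obtain ⟨x, hx, hxB⟩ := ((frequently_ae_mem_iff.2 hpos).and_eventually hB).exists
    have h1 := ENNReal.rpow_le_rpow hxB hq0.le
    rw [ENNReal.mul_rpow_of_nonneg _ _ hq0.le, ← ENNReal.rpow_mul, one_div_mul_cancel hq0.ne',
      ENNReal.rpow_one] at h1
    have h2 : (2 : ℝ≥0∞) ^ (n : ℝ) = 2 * 2 ^ ((n : ℝ) - 1) := by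
      nth_rewrite 2 [← ENNReal.rpow_one 2]
      rw [← two_rpow_add]
      congr 1; ring
    rw [h2, mul_assoc]
    gcongr
    refine le_trans ?_ h1
    rw [mul_comm]
    gcongr
    · exact lNorm_mono_set _ _ (tailBlock_subset_Ioo hx)
    · have := hx.2.1.le
      push_cast at this
      exact this
  push_cast
  rw [mul_assoc, ENNReal.mul_rpow_of_nonneg _ _ hq0.le, hν.setLIntegral_Ioi_eq_tsum, ← mul_assoc 2]
  gcongr
  refine le_trans ?_ (mul_le_mul_right (tsum_rpow_le_rpow_tsum hq _) _)
  rw [← ENNReal.tsum_mul_left]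
  refine ENNReal.tsum_le_tsum fun n => ?_
  rw [ENNReal.mul_rpow_of_nonneg _ _ hq0.le, mul_left_comm, mul_comm]
  exact mul_le_mul_left (key n) _

theorem cesModular_le_of_lt_one {p q : ℝ} (hp : 0 < p) (hp1 : p ≤ 1) (hq : 0 < q) (hq1 : q < 1) :
    ∃ C : ℝ≥0, ∀ ν, IsTailMeasure ν → ∀ h F : ℝ → ℝ≥0∞,
      AEMeasurable h (volume.restrict (Ioi 0)) → AEMeasurable F (volume.restrict (Ioi 0)) →
      cesModular p q ν (fun x => h x * F x) ≤
        C * (∫⁻ x, (lNorm (conjExp (ENNReal.ofReal p)) (Ioo 0 x) F * ν (Ioi x)) ^ (q / (1 - q)) ∂ν) ^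
          (1 - q) * (∫⁻ x in Ioi 0, h x) ^ q := by
  obtain ⟨C, hC⟩ := cesModular_le_tsum hp hp1 hq
  have hq1' : 0 < 1 - q := by linarith
  set q' := q / (1 - q) with hq'
  have hq'0 : 0 < q' := by positivity
  refine ⟨C * (2 ^ (2 + q')) ^ (1 - q), fun ν hν h F hh hF => (hC ν hν h F hh hF).trans ?_⟩
  set b : ℤ → ℝ≥0∞ := fun n => lNorm (conjExp (ENNReal.ofReal p)) (tailBlock ν n) F with hb
  set J := ∫⁻ x, (lNorm (conjExp (ENNReal.ofReal p)) (Ioo 0 x) F * ν (Ioi x)) ^ q' ∂ν with hJ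
  have key : ∑' n : ℤ, ((2 : ℝ≥0∞) ^ (n : ℝ) * b n ^ q) ^ (1 / (1 - q)) ≤ 2 ^ (2 + q') * J := by
    rw [hJ, hν.lintegral_eq_tsum_sub_one, ← ENNReal.tsum_mul_left]
    refine ENNReal.tsum_le_tsum fun n => ?_
    have hs : (0 : ℝ) < 1 / (1 - q) := by positivity
    rcases (tailBlock ν n).eq_empty_or_nonempty with he | hne
    · simp only [hb, he, lNorm_empty, ENNReal.zero_rpow_of_pos hq, mul_zero,
        ENNReal.zero_rpow_of_pos hs]
      exact zero_le
    calc ((2 : ℝ≥0∞) ^ (n : ℝ) * b n ^ q) ^ (1 / (1 - q))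
        = 2 ^ (2 + q') * ((b n * 2 ^ ((n : ℝ) - 1)) ^ q' * 2 ^ ((n : ℝ) - 2)) := by
          rw [ENNReal.mul_rpow_of_nonneg _ _ hs.le, ENNReal.mul_rpow_of_nonneg _ _ hq'0.le,
            ← ENNReal.rpow_mul, ← ENNReal.rpow_mul, ← ENNReal.rpow_mul, mul_one_div q, ← hq']
          -- As `1/(1-q) = q' + 1`, the power of `2` splits between the tail, above `2^{n-1}`, and
          -- the mass of block `n - 1`, at least `2^{n-2}`.
          have : (n : ℝ) * (1 / (1 - q)) = (2 + q') + (((n : ℝ) - 1) * q' + (n - 2)) := by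
            rw [hq']; field_simp; ring
          rw [this, two_rpow_add (2 + q'), two_rpow_add (((n : ℝ) - 1) * q')]
          ring
      _ ≤ 2 ^ (2 + q') * ((b n * 2 ^ ((n : ℝ) - 1)) ^ q' * ν (tailBlock ν (n - 1))) := by
          gcongr
          exact hν.le_measure_tailBlock hne
      _ ≤ _ := by
          gcongr
          refine mul_measure_le_setLIntegral (measurableSet_tailBlock _ _) fun x hx => ?_
          gcongr
          · exact lNorm_mono_set _ _ (tailBlock_subset_Ioo hx)
          · have := hx.2.1.le
            push_cast at this
            exact this
  have hcoe : ((2 ^ (2 + q') : ℝ≥0) : ℝ≥0∞) = 2 ^ (2 + q') :=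
    ENNReal.coe_rpow_of_ne_zero two_ne_zero _
  rw [ENNReal.coe_mul, ENNReal.coe_rpow_of_nonneg _ hq1'.le, hcoe, mul_assoc, mul_assoc]
  gcongr
  calc _ = ∑' n : ℤ, (∫⁻ x in tailBlock ν n, h x) ^ q * ((2 : ℝ≥0∞) ^ (n : ℝ) * b n ^ q) := by
        congr 1
        ext n
        rw [ENNReal.mul_rpow_of_nonneg _ _ hq.le, mul_left_comm]
    _ ≤ (∑' n : ℤ, ∫⁻ x in tailBlock ν n, h x) ^ q *
          (∑' n : ℤ, ((2 : ℝ≥0∞) ^ (n : ℝ) * b n ^ q) ^ (1 / (1 - q))) ^ (1 - q) :=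
        tsum_mul_rpow_le hq hq1 _ _
    _ ≤ (∑' n : ℤ, ∫⁻ x in tailBlock ν n, h x) ^ q * (2 ^ (2 + q') * J) ^ (1 - q) := by
        gcongr
    _ = _ := by
        rw [hν.setLIntegral_Ioi_eq_tsum, ENNReal.mul_rpow_of_nonneg _ _ hq1'.le]
        ring

/-! ### Necessity by test functions -/

/-- The bound on the multiplier problem after its reduction to `L¹`. -/
def IsL1Bound (p q : ℝ) (ν : Measure ℝ) (F : ℝ → ℝ≥0∞) (R : ℝ≥0∞) : Prop :=
  ∀ h : ℝ → ℝ≥0∞, Measurable h → ∫⁻ x in Ioi 0, h x < ∞ →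
    cesModular p q ν (fun x => h x * F x) ≤ R * (∫⁻ x in Ioi 0, h x) ^ q

/-- A test function concentrated on `(0,x)` makes the inner integral at least `c^p` for every `y >
x`, so the modular is at least `c^q ν(x,∞)`. -/
theorem IsL1Bound.tail_mul_le {p q : ℝ} (hp : 0 < p) (hp1 : p ≤ 1) (hq : 0 < q) {ν : Measure ℝ}
    (hν : IsTailMeasure ν) {F : ℝ → ℝ≥0∞} (hF : AEMeasurable F (volume.restrict (Ioi 0)))
    {R : ℝ≥0∞} (hR : IsL1Bound p q ν F R) {x : ℝ} (hx : 0 < x) :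
    lNorm (conjExp (ENNReal.ofReal p)) (Ioo 0 x) F * ν (Ioi x) ^ (1 / q) ≤ R ^ (1 / q) := by
  rw [← ENNReal.le_div_iff_mul_le
    (Or.inl (ENNReal.rpow_pos (hν.pos x hx) (hν.lt_top x hx).ne).ne')
    (Or.inl (ENNReal.rpow_ne_top_of_nonneg (by positivity) (hν.lt_top x hx).ne)),
    ← ENNReal.div_rpow_of_nonneg _ _ (by positivity)]
  refine le_of_forall_lt_imp_le_of_dense fun c hc => ?_
  have hr := Measure.restrict_mono (μ := volume) (Ioo_subset_Ioi_self : Ioo 0 x ⊆ Ioi 0) le_rfl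
  obtain ⟨h, hm, -, h1, hch⟩ :=
    exists_test_function hp hp1 measurableSet_Ioo (hF.mono_measure hr) hc
  have h1' : ∫⁻ x in Ioi 0, h x ≤ 1 := (setLIntegral_le_lintegral _ _).trans h1
  have hK := (hR h hm (h1'.trans_lt ENNReal.one_lt_top)).trans
    (mul_le_of_le_one_right zero_le (ENNReal.rpow_le_one h1' hq.le))
  have hlow : c ^ q * ν (Ioi x) ≤ cesModular p q ν (fun x => h x * F x) := by
    refine le_trans (mul_measure_le_setLIntegral measurableSet_Ioi fun y hy => ?_)
      (setLIntegral_le_lintegral (Ioi x) _)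
    calc c ^ q = (c ^ p) ^ (q / p) := by rw [← ENNReal.rpow_mul, mul_div_cancel₀ _ hp.ne']
      _ ≤ _ := by
        refine ENNReal.rpow_le_rpow (hch.trans ?_) (by positivity)
        exact lintegral_mono_set (Ioo_subset_Ioo_right hy.le)
  have h2 : c ^ q ≤ R / ν (Ioi x) :=
    (ENNReal.le_div_iff_mul_le (Or.inl (hν.pos x hx).ne') (Or.inl (hν.lt_top x hx).ne)).2
      (hlow.trans hK)
  have h3 := ENNReal.rpow_le_rpow h2 (by positivity : 0 ≤ 1 / q)
  rwa [← ENNReal.rpow_mul, mul_one_div_cancel hq.ne', ENNReal.rpow_one] at h3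

theorem IsL1Bound.lNorm_tailBlock_lt_top {p q : ℝ} (hp : 0 < p) (hp1 : p ≤ 1) (hq : 0 < q)
    {ν : Measure ℝ} (hν : IsTailMeasure ν) {F : ℝ → ℝ≥0∞}
    (hF : AEMeasurable F (volume.restrict (Ioi 0))) {R : ℝ≥0∞} (hR : IsL1Bound p q ν F R)
    (hRt : R ≠ ∞) (n : ℤ) : lNorm (conjExp (ENNReal.ofReal p)) (tailBlock ν n) F < ∞ := by
  rcases (tailBlock ν n).eq_empty_or_nonempty with he | hne
  · rw [he, lNorm_empty]; exact ENNReal.zero_lt_top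
  have hpos : ν (tailBlock ν (n - 1)) ≠ 0 :=
    ((pos_iff_ne_zero.2 (two_rpow_ne_zero _)).trans_le (hν.le_measure_tailBlock hne)).ne'
  obtain ⟨x, hx⟩ := nonempty_of_measure_ne_zero hpos
  refine (lNorm_mono_set _ _ (tailBlock_subset_Ioo hx)).trans_lt ?_
  have h := (hR.tail_mul_le hp hp1 hq hν hF hx.1).trans_lt
    (ENNReal.rpow_lt_top_of_nonneg (by positivity) hRt)
  refine lt_top_iff_ne_top.2 fun ht => h.ne ?_
  rw [ht, ENNReal.top_mul (ENNReal.rpow_pos (hν.pos x hx.1) (hν.lt_top x hx.1).ne).ne']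

/-- The coefficients `θ n` are extremal for the discrete problem: `θ n = (θ n)^q 2^n b_n^q`. Testing
with `∑ θ n * h n` gives `Θ ≤ 2^{2+q} R Θ^q`. Here `2^q` pays for reaching only half of `b_n`, and
`2^2` for the mass `2^{n-2}`. -/
theorem IsL1Bound.tsum_le {p q : ℝ} (hp : 0 < p) (hp1 : p ≤ 1) (hq : 0 < q) (hq1 : q < 1)
    {ν : Measure ℝ} (hν : IsTailMeasure ν) {F : ℝ → ℝ≥0∞}
    (hF : AEMeasurable F (volume.restrict (Ioi 0))) {R : ℝ≥0∞} (hR : IsL1Bound p q ν F R) :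
    ∑' n : ℤ, ((2 : ℝ≥0∞) ^ (n : ℝ) *
        lNorm (conjExp (ENNReal.ofReal p)) (tailBlock ν n) F ^ q) ^ (1 / (1 - q)) ≤
      (2 ^ (2 + q) * R) ^ (1 / (1 - q)) := by
  have hq1' : 0 < 1 - q := by linarith
  have hs : 0 < 1 / (1 - q) := by positivity
  rcases eq_or_ne R ∞ with rfl | hRt
  · rw [ENNReal.mul_top (two_rpow_ne_zero _), ENNReal.top_rpow_of_pos hs]
    exact le_top
  set b : ℤ → ℝ≥0∞ := fun n => lNorm (conjExp (ENNReal.ofReal p)) (tailBlock ν n) F with hb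
  have hbt : ∀ n, b n < ∞ := hR.lNorm_tailBlock_lt_top hp hp1 hq hν hF hRt
  set θ : ℤ → ℝ≥0∞ := fun n => ((2 : ℝ≥0∞) ^ (n : ℝ) * b n ^ q) ^ (1 / (1 - q)) with hθ
  have hθt : ∀ n, θ n ≠ ∞ := fun n => ENNReal.rpow_ne_top_of_nonneg hs.le
    (ENNReal.mul_ne_top (two_rpow_ne_top _) (ENNReal.rpow_ne_top_of_nonneg hq.le (hbt n).ne))
  have htest : ∀ n, ∃ h : ℝ → ℝ≥0∞, Measurable h ∧ ∫⁻ x, h x ≤ 1 ∧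
      (b n / 2) ^ p ≤ ∫⁻ x in tailBlock ν n, (h x * F x) ^ p := by
    intro n
    rcases eq_or_ne (b n) 0 with h0 | h0
    · refine ⟨0, measurable_zero, by simp, ?_⟩
      rw [h0, ENNReal.zero_div, ENNReal.zero_rpow_of_pos hp]
      exact zero_le
    · have hr := Measure.restrict_mono (μ := volume) (tailBlock_subset ν n) le_rfl
      obtain ⟨h, h1, -, h2, h3⟩ := exists_test_function hp hp1 (measurableSet_tailBlock ν n)
        (hF.mono_measure hr) (ENNReal.half_lt_self h0 (hbt n).ne)
      exact ⟨h, h1, h2, h3⟩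
  choose h hm h1 hlow using htest
  -- Finite partial sums keep `Θ` finite, so that `Θ^q` can be divided out at the end.
  rw [ENNReal.tsum_eq_iSup_sum]
  refine iSup_le fun K => ?_
  set Θ := ∑ n ∈ K, θ n with hΘ
  have hΘt : Θ ≠ ∞ := ENNReal.sum_ne_top.2 fun n _ => hθt n
  set H : ℝ → ℝ≥0∞ := fun x => ∑ n ∈ K, θ n * h n x with hH
  have hHm : Measurable H := Finset.measurable_sum _ fun n _ => (hm n).const_mul _
  have hHΘ : ∫⁻ x in Ioi 0, H x ≤ Θ := by
    refine (setLIntegral_le_lintegral _ _).trans ?_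
    rw [lintegral_finsetSum _ fun n _ => (hm n).const_mul _]
    refine Finset.sum_le_sum fun n _ => ?_
    rw [lintegral_const_mul _ (hm n)]
    exact mul_le_of_le_one_right zero_le (h1 n)
  have hup : cesModular p q ν (fun x => H x * F x) ≤ R * Θ ^ q :=
    (hR H hHm (hHΘ.trans_lt hΘt.lt_top)).trans (by gcongr)
  have hlo : Θ ≤ 2 ^ (2 + q) * cesModular p q ν (fun x => H x * F x) := by
    rw [cesModular, hν.lintegral_eq_tsum_sub_one]
    refine le_trans ?_ (mul_le_mul_right (ENNReal.sum_le_tsum K) _)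
    rw [Finset.mul_sum]
    refine Finset.sum_le_sum fun n hn => ?_
    rcases (tailBlock ν n).eq_empty_or_nonempty with he | hne
    · simp only [hθ, hb, he, lNorm_empty, ENNReal.zero_rpow_of_pos hq, mul_zero,
        ENNReal.zero_rpow_of_pos hs]
      exact zero_le
    calc θ n = θ n ^ q * ((2 : ℝ≥0∞) ^ (n : ℝ) * b n ^ q) := by
          have e : (2 : ℝ≥0∞) ^ (n : ℝ) * b n ^ q = θ n ^ (1 - q) := by
            rw [hθ, ← ENNReal.rpow_mul, one_div_mul_cancel hq1'.ne', ENNReal.rpow_one]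
          rw [e, ← ENNReal.rpow_add_of_nonneg _ _ hq.le hq1'.le, add_sub_cancel,
            ENNReal.rpow_one]
      _ = 2 ^ (2 + q) * ((θ n * (b n / 2)) ^ q * 2 ^ ((n : ℝ) - 2)) := by
          rw [div_eq_mul_inv, ENNReal.mul_rpow_of_nonneg _ _ hq.le,
            ENNReal.mul_rpow_of_nonneg _ _ hq.le, ENNReal.inv_rpow, ← ENNReal.rpow_neg,
            show (n : ℝ) = (2 + q) + (-q + (n - 2)) by ring, two_rpow_add (2 + q),
            two_rpow_add (-q), show (2 + q) + (-q + ((n : ℝ) - 2)) - 2 = n - 2 by ring]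
          ring
      _ ≤ 2 ^ (2 + q) * ((θ n * (b n / 2)) ^ q * ν (tailBlock ν (n - 1))) := by
          gcongr
          exact hν.le_measure_tailBlock hne
      _ ≤ _ := by
          gcongr
          refine mul_measure_le_setLIntegral (measurableSet_tailBlock _ _) fun x hx => ?_
          calc (θ n * (b n / 2)) ^ q = (θ n ^ p * (b n / 2) ^ p) ^ (q / p) := by
                rw [← ENNReal.mul_rpow_of_nonneg _ _ hp.le, ← ENNReal.rpow_mul,
                  mul_div_cancel₀ _ hp.ne']
            _ ≤ (θ n ^ p * ∫⁻ t in tailBlock ν n, (h n t * F t) ^ p) ^ (q / p) := by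
                gcongr
                exact hlow n
            _ ≤ _ := by
                refine ENNReal.rpow_le_rpow ?_ (by positivity)
                rw [← lintegral_const_mul' _ _ (ENNReal.rpow_ne_top_of_nonneg hp.le (hθt n))]
                refine le_trans (lintegral_mono fun t => ?_)
                  (lintegral_mono_set (tailBlock_subset_Ioo hx))
                rw [← ENNReal.mul_rpow_of_nonneg _ _ hp.le, ← mul_assoc]
                gcongr
                exact Finset.single_le_sum (f := fun n => θ n * h n t) (fun _ _ => zero_le) hn
  have hfin : Θ ≤ 2 ^ (2 + q) * R * Θ ^ q := by
    rw [mul_assoc]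
    exact hlo.trans (by gcongr)
  rcases eq_or_ne Θ 0 with h0 | h0
  · rw [h0]; exact zero_le
  have h2 : Θ ^ (1 - q) ≤ 2 ^ (2 + q) * R := by
    rw [ENNReal.rpow_sub _ _ h0 hΘt, ENNReal.rpow_one]
    exact ENNReal.div_le_of_le_mul hfin
  have h3 := ENNReal.rpow_le_rpow h2 hs.le
  rwa [← ENNReal.rpow_mul, mul_one_div_cancel hq1'.ne', ENNReal.rpow_one] at h3

/-- On block `n` both the tail and the mass are at most `2^{n+1}`, which produces the weight
`2^{n/(1-q)}`. The norm over `(0,x)` is split over the blocks by subadditivity of its power `σ`, and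
the Hardy inequality is applied with exponent `q'/σ`. -/
theorem lintegral_conj_le_tsum {p q : ℝ} (hp : 0 < p) (hp1 : p ≤ 1) (hq : 0 < q) (hq1 : q < 1) :
    ∃ C : ℝ≥0, ∀ ν, IsTailMeasure ν → ∀ F : ℝ → ℝ≥0∞,
      ∫⁻ x, (lNorm (conjExp (ENNReal.ofReal p)) (Ioo 0 x) F * ν (Ioi x)) ^ (q / (1 - q)) ∂ν ≤
        C * ∑' n : ℤ, ((2 : ℝ≥0∞) ^ (n : ℝ) *
          lNorm (conjExp (ENNReal.ofReal p)) (tailBlock ν n) F ^ q) ^ (1 / (1 - q)) := by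
  have hq1' : 0 < 1 - q := by linarith
  have hs : 0 < 1 / (1 - q) := by positivity
  set q' := q / (1 - q) with hq'
  have hq'0 : 0 < q' := by positivity
  set σ := conjPow p with hσ
  have hσ0 : 0 < σ := conjPow_pos hp
  obtain ⟨C, hC⟩ := tsum_dyadic_hardy hs (div_pos hq'0 hσ0)
  refine ⟨2 ^ (1 / (1 - q)) * C, fun ν hν F => ?_⟩
  set b : ℤ → ℝ≥0∞ := fun n => lNorm (conjExp (ENNReal.ofReal p)) (tailBlock ν n) F with hb
  rw [hν.lintegral_eq_tsum]
  calc _ ≤ ∑' n : ℤ, (2 : ℝ≥0∞) ^ (1 / (1 - q)) *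
        (2 ^ (1 / (1 - q) * n) * (∑' i : ℕ, b (n + i) ^ σ) ^ (q' / σ)) := by
        refine ENNReal.tsum_le_tsum fun n => ?_
        refine (setLIntegral_le_mul_measure (measurableSet_tailBlock ν n)
          (c := (∑' i : ℕ, b (n + i) ^ σ) ^ (q' / σ) * (2 ^ ((n : ℝ) + 1)) ^ q')
          fun x hx => ?_).trans ?_
        · rw [ENNReal.mul_rpow_of_nonneg _ _ hq'0.le]
          have hG := (ENNReal.rpow_le_rpow (lNorm_mono_set (conjExp (ENNReal.ofReal p)) F
            (hν.Ioo_subset_iUnion hx)) hσ0.le).trans (lNorm_conjExp_iUnion_le hp hp1 _ F)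
          have hG' := ENNReal.rpow_le_rpow hG (by positivity : 0 ≤ q' / σ)
          rw [← ENNReal.rpow_mul, mul_div_cancel₀ _ hσ0.ne'] at hG'
          gcongr
          exact hx.2.2
        · refine (mul_le_mul_right (hν.measure_tailBlock_le n) _).trans (le_of_eq ?_)
          rw [← ENNReal.rpow_mul, mul_assoc, ← two_rpow_add, ← mul_assoc, ← two_rpow_add, mul_comm]
          congr 2
          rw [hq']; field_simp; ring
    _ ≤ (2 : ℝ≥0∞) ^ (1 / (1 - q)) * (C * ∑' n : ℤ, (2 : ℝ≥0∞) ^ (1 / (1 - q) * n) *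
          (b n ^ σ) ^ (q' / σ)) := by
        rw [ENNReal.tsum_mul_left]
        gcongr
        exact hC _
    _ = _ := by
        have hcoe : ((2 ^ (1 / (1 - q)) : ℝ≥0) : ℝ≥0∞) = 2 ^ (1 / (1 - q)) :=
          ENNReal.coe_rpow_of_ne_zero two_ne_zero _
        rw [ENNReal.coe_mul, hcoe, mul_assoc]
        congr 3
        ext n
        rw [ENNReal.mul_rpow_of_nonneg _ _ hs.le, ← ENNReal.rpow_mul, ← ENNReal.rpow_mul,
          ← ENNReal.rpow_mul, mul_div_cancel₀ _ hσ0.ne', mul_one_div q, mul_comm (n : ℝ)]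


/-! ### Reduction of the multiplier problem to `L¹` -/

theorem cesModular_mono {p q : ℝ} (hp : 0 < p) (hq : 0 < q) (ν : Measure ℝ) {φ ψ : ℝ → ℝ≥0∞}
    (h : ∀ x, φ x ≤ ψ x) : cesModular p q ν φ ≤ cesModular p q ν ψ :=
  lintegral_mono fun _ => ENNReal.rpow_le_rpow
    (lintegral_mono fun t => ENNReal.rpow_le_rpow (h t) hp.le) (by positivity)

theorem cesModular_congr_ae {p q : ℝ} (ν : Measure ℝ) {φ ψ : ℝ → ℝ≥0∞}
    (h : φ =ᵐ[halfLine] ψ) : cesModular p q ν φ = cesModular p q ν ψ := by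
  refine lintegral_congr fun x => ?_
  congr 1
  refine lintegral_congr_ae ?_
  filter_upwards [ae_mono (Measure.restrict_mono (Ioo_subset_Ioi_self : Ioo 0 x ⊆ Ioi 0) le_rfl) h]
    with t ht
  rw [ht]

theorem cesModular_const_mul {p q : ℝ} (hp : 0 < p) (hq : 0 < q) (ν : Measure ℝ) {c : ℝ≥0∞}
    (hc : c ≠ ∞) (φ : ℝ → ℝ≥0∞) :
    cesModular p q ν (fun x => c * φ x) = c ^ q * cesModular p q ν φ := by
  rw [cesModular, cesModular, ← lintegral_const_mul' _ _ (ENNReal.rpow_ne_top_of_nonneg hq.le hc)]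
  refine lintegral_congr fun x => ?_
  simp_rw [ENNReal.mul_rpow_of_nonneg _ _ hp.le]
  rw [lintegral_const_mul' _ _ (ENNReal.rpow_ne_top_of_nonneg hp.le hc),
    ENNReal.mul_rpow_of_nonneg _ _ (by positivity : 0 ≤ q / p), ← ENNReal.rpow_mul,
    mul_div_cancel₀ _ hp.ne']

theorem cesModular_eq_zero {p q : ℝ} (hp : 0 < p) (hq : 0 < q) (ν : Measure ℝ) {φ : ℝ → ℝ≥0∞}
    (h : φ =ᵐ[halfLine] 0) : cesModular p q ν φ = 0 := by
  rw [cesModular_congr_ae ν h]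
  simp [cesModular, ENNReal.zero_rpow_of_pos hp, ENNReal.zero_rpow_of_pos (div_pos hq hp)]

/-- If every `L¹` function is mapped into the Cesàro space, the mapping is bounded. -/
theorem exists_isL1Bound {p q : ℝ} (hp : 0 < p) (hq : 0 < q) {ν : Measure ℝ} {F : ℝ → ℝ≥0∞}
    (hfin : ∀ h : ℝ → ℝ≥0∞, Measurable h → ∫⁻ x in Ioi 0, h x < ∞ →
      cesModular p q ν (fun x => h x * F x) < ∞) :
    ∃ R : ℝ≥0∞, R ≠ ∞ ∧ IsL1Bound p q ν F R := by
  by_contra! hcon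
  have hex : ∀ n : ℕ, ∃ h : ℝ → ℝ≥0∞, Measurable h ∧ ∫⁻ x in Ioi 0, h x ≤ 2⁻¹ ^ n ∧
      n ≤ cesModular p q ν (fun x => h x * F x) := by
    intro n
    -- The constant is chosen so that rescaling `h` to integral `2^{-n}` leaves a modular of at
    -- least `n`. The sum of the rescaled functions is then integrable and dominates each of them.
    have h0 := hcon (n * (2 ^ n) ^ q) (ENNReal.mul_ne_top (ENNReal.natCast_ne_top n)
      (ENNReal.rpow_ne_top_of_nonneg hq.le (ENNReal.pow_ne_top ENNReal.ofNat_ne_top)))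
    simp only [IsL1Bound, not_forall, not_le] at h0
    obtain ⟨h, hm, ht, hlt⟩ := h0
    set a := ∫⁻ x in Ioi 0, h x with ha
    have ha0 : a ≠ 0 := fun h0 => by
      have hz : h =ᵐ[halfLine] 0 := (lintegral_eq_zero_iff hm).1 h0
      rw [cesModular_eq_zero hp hq ν (by filter_upwards [hz] with x hx; simp [hx])] at hlt
      exact not_lt_zero hlt
    have hct : (2⁻¹ : ℝ≥0∞) ^ n * a⁻¹ ≠ ∞ :=
      ENNReal.mul_ne_top (ENNReal.pow_ne_top (by simp)) (ENNReal.inv_ne_top.2 ha0)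
    refine ⟨fun x => (2⁻¹ ^ n * a⁻¹) * h x, hm.const_mul _, ?_, ?_⟩
    · rw [lintegral_const_mul _ hm, ← ha, mul_assoc, ENNReal.inv_mul_cancel ha0 ht.ne, mul_one]
    · simp_rw [mul_assoc (2⁻¹ ^ n * a⁻¹)]
      rw [cesModular_const_mul hp hq ν hct]
      refine le_trans (le_of_eq ?_) (mul_le_mul_right hlt.le _)
      rw [mul_assoc, ← ENNReal.mul_rpow_of_nonneg _ _ hq.le, mul_left_comm,
        ← ENNReal.mul_rpow_of_nonneg _ _ hq.le,
        show (2⁻¹ : ℝ≥0∞) ^ n * a⁻¹ * (2 ^ n * a) = (2⁻¹ ^ n * 2 ^ n) * (a⁻¹ * a) by ring,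
        ENNReal.inv_mul_cancel ha0 ht.ne, ← mul_pow,
        ENNReal.inv_mul_cancel two_ne_zero ENNReal.ofNat_ne_top]
      simp
  choose h hm hle hge using hex
  have hsum : ∫⁻ x in Ioi 0, ∑' n, h n x < ∞ := by
    rw [lintegral_tsum fun n => (hm n).aemeasurable]
    refine (ENNReal.tsum_le_tsum hle).trans_lt ?_
    rw [ENNReal.tsum_geometric, ENNReal.one_sub_inv_two, inv_inv]
    exact ENNReal.ofNat_lt_top
  have hlt := hfin _ (Measurable.tsum hm) hsum
  obtain ⟨n, hn⟩ := ENNReal.exists_nat_gt hlt.ne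
  refine hn.not_ge ((hge n).trans (cesModular_mono hp hq ν fun x => ?_))
  gcongr
  exact ENNReal.le_tsum (f := fun n => h n x) n

/-! ### Translation between the weighted spaces and the reduced inequality -/

section Weights

variable {p q : ℝ} {u v w : ℝ → ℝ≥0∞}

theorem opA_one_one (u : ℝ → ℝ≥0∞) (x : ℝ) : opA 1 1 u x = (∫⁻ t in Ioo 0 x, u t)⁻¹ := by
  simp [opA, ENNReal.rpow_neg_one]

theorem lintegral_Ioo_pos_of_mem_omegaDual (hu : u ∈ OmegaDual 1) {x : ℝ} (hx : 0 < x) :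
    ∫⁻ t in Ioo 0 x, u t ≠ 0 ∧ ∫⁻ t in Ioo 0 x, u t ≠ ∞ := by
  have h := hu.2 x hx
  simp only [lNorm, eLpNorm_one_eq_lintegral_enorm, enorm_eq_self] at h
  exact ⟨h.1.ne', h.2.ne⟩

theorem measurable_lintegral_Ioo (u : ℝ → ℝ≥0∞) : Measurable fun x => ∫⁻ t in Ioo 0 x, u t :=
  Monotone.measurable fun _ _ h => lintegral_mono_set (Ioo_subset_Ioo_right h)

/-- The measure `w ^ q dx` on `(0,∞)`. -/
noncomputable def powMeasure (q : ℝ) (w : ℝ → ℝ≥0∞) : Measure ℝ :=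
  halfLine.withDensity fun x => w x ^ q

theorem powMeasure_Ioi {x : ℝ} (hx : 0 < x) :
    powMeasure q w (Ioi x) = ∫⁻ t in Ioi x, w t ^ q := by
  rw [powMeasure, withDensity_apply _ measurableSet_Ioi, halfLine,
    Measure.restrict_restrict measurableSet_Ioi, inter_eq_left.2 (Ioi_subset_Ioi hx.le)]

theorem isTailMeasure_powMeasure (hq : 0 < q) (hw : w ∈ Omega (ENNReal.ofReal q)) :
    IsTailMeasure (powMeasure q w) := by
  have hac : powMeasure q w ≪ halfLine := withDensity_absolutelyContinuous _ _
  have hlt : ∀ t, 0 < t → 0 < powMeasure q w (Ioi t) ∧ powMeasure q w (Ioi t) < ∞ := by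
    intro t ht
    have h := hw.2 t ht
    rw [lNorm_ofReal hq] at h
    rw [powMeasure_Ioi ht]
    exact ⟨by_contra fun h0 => by
      rw [not_lt, nonpos_iff_eq_zero] at h0
      rw [h0, ENNReal.zero_rpow_of_pos (by positivity)] at h
      exact h.1.false, by_contra fun h0 => by
      rw [not_lt, top_le_iff] at h0
      rw [h0, ENNReal.top_rpow_of_pos (by positivity)] at h
      exact h.2.false⟩
  refine ⟨hac ?_, fun x => hac ?_, fun t ht => (hlt t ht).1, fun t ht => (hlt t ht).2⟩
  · rw [halfLine, Measure.restrict_apply measurableSet_Iic, Iic_inter_Ioi, Ioc_self,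
      measure_empty]
  · exact Measure.absolutelyContinuous_of_le Measure.restrict_le_self (measure_singleton x)

theorem aemeasurable_rpow_of_mem_omega {s : ℝ≥0∞} (hw : w ∈ Omega s) (q : ℝ) :
    AEMeasurable (fun x => w x ^ q) halfLine :=
  AEMeasurable.pow_const hw.1 q

theorem lintegral_powMeasure {s : ℝ≥0∞} (hw : w ∈ Omega s) {f : ℝ → ℝ≥0∞} (hf : Measurable f) :
    ∫⁻ x, f x ∂powMeasure q w = ∫⁻ x in Ioi 0, f x * w x ^ q := by
  rw [powMeasure, lintegral_withDensity_eq_lintegral_mul₀ (aemeasurable_rpow_of_mem_omega hw q)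
    hf.aemeasurable]
  simp_rw [Pi.mul_apply, mul_comm]
  rfl

theorem measurable_lNorm_Ioo (s : ℝ≥0∞) (F : ℝ → ℝ≥0∞) :
    Measurable fun x => lNorm s (Ioo 0 x) F :=
  Monotone.measurable fun _ _ h => lNorm_mono_set s F (Ioo_subset_Ioo_right h)

theorem cesNorm_eq_cesModular (hp : 0 < p) (hq : 0 < q) {s : ℝ≥0∞} (hw : w ∈ Omega s)
    (f : ℝ → ℝ≥0∞) :
    cesNorm (ENNReal.ofReal p) (ENNReal.ofReal q) w v f =
      cesModular p q (powMeasure q w) (fun x => f x * v x) ^ (1 / q) := by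
  rw [cesNorm, wLNorm, lNorm_ofReal hq, cesModular, lintegral_powMeasure hw]
  · congr 1
    refine lintegral_congr fun x => ?_
    rw [wLNorm, lNorm_ofReal hp, ENNReal.mul_rpow_of_nonneg _ _ hq.le, ← ENNReal.rpow_mul,
      one_div_mul_eq_div]
  · exact (measurable_lintegral_Ioo _).pow_const _

/-- Tonelli on the triangle `0 < x < t`, carried out with measurable representatives to obtain a
jointly measurable kernel. -/
theorem copNorm_one_eq (hu : u ∈ OmegaDual 1) {g : ℝ → ℝ≥0∞} (hg : g ∈ MPlus) :
    copNorm 1 1 u 1 g = ∫⁻ t in Ioi 0, g t * ∫⁻ x in Ioo 0 t, u x := by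
  have hg' : AEMeasurable g (volume.restrict (Ioi 0)) := hg
  have hu' : AEMeasurable u (volume.restrict (Ioi 0)) := hu.1
  have hm : Measurable fun z : ℝ × ℝ =>
      (Ioi z.1).indicator (fun t => hg'.mk g t * hu'.mk u z.1) z.2 := by
    refine Measurable.ite (measurableSet_lt measurable_fst measurable_snd) ?_ measurable_const
    exact (hg'.measurable_mk.comp measurable_snd).mul (hu'.measurable_mk.comp measurable_fst)
  simp only [copNorm, wLNorm, lNorm, eLpNorm_one_eq_lintegral_enorm, enorm_eq_self,
    Pi.one_apply, mul_one]
  calc _ = ∫⁻ x in Ioi 0, ∫⁻ t in Ioi 0,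
        (Ioi x).indicator (fun t => hg'.mk g t * hu'.mk u x) t := by
        refine lintegral_congr_ae ?_
        filter_upwards [hu'.ae_eq_mk, ae_restrict_mem measurableSet_Ioi] with x hx hx0
        rw [setLIntegral_indicator measurableSet_Ioi, inter_eq_left.2 (Ioi_subset_Ioi hx0.le),
          lintegral_mul_const _ hg'.measurable_mk, hx]
        congr 1
        exact lintegral_congr_ae
          (ae_mono (Measure.restrict_mono (Ioi_subset_Ioi hx0.le) le_rfl) hg'.ae_eq_mk)
    _ = ∫⁻ t in Ioi 0, ∫⁻ x in Ioi 0,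
        (Ioi x).indicator (fun t => hg'.mk g t * hu'.mk u x) t :=
        lintegral_lintegral_swap hm.aemeasurable
    _ = _ := by
        refine lintegral_congr_ae ?_
        filter_upwards [hg'.ae_eq_mk, ae_restrict_mem measurableSet_Ioi] with t ht ht0
        have e : ∀ x, (Ioi x).indicator (fun t => hg'.mk g t * hu'.mk u x) t =
            (Iio t).indicator (fun x => hg'.mk g t * hu'.mk u x) x := fun x => by
          simp only [indicator, mem_Ioi, mem_Iio]
        simp_rw [e]
        rw [setLIntegral_indicator measurableSet_Iio, inter_comm, Ioi_inter_Iio,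
          lintegral_const_mul _ hu'.measurable_mk, ht]
        congr 1
        exact lintegral_congr_ae
          (ae_mono (Measure.restrict_mono Ioo_subset_Ioi_self le_rfl) hu'.ae_eq_mk.symm)

theorem div_primitive_mem_MPlus {h : ℝ → ℝ≥0∞} (hh : h ∈ MPlus) (u : ℝ → ℝ≥0∞) :
    (fun x => h x * opA 1 1 u x) ∈ MPlus := by
  simp_rw [opA_one_one]
  exact AEMeasurable.mul hh (measurable_lintegral_Ioo u).inv.aemeasurable

theorem copNorm_div_primitive (hu : u ∈ OmegaDual 1) {h : ℝ → ℝ≥0∞} (hh : h ∈ MPlus) :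
    copNorm 1 1 u 1 (fun x => h x * opA 1 1 u x) = ∫⁻ x in Ioi 0, h x := by
  rw [copNorm_one_eq hu (div_primitive_mem_MPlus hh u)]
  refine setLIntegral_congr_fun measurableSet_Ioi fun x hx => ?_
  obtain ⟨h0, ht⟩ := lintegral_Ioo_pos_of_mem_omegaDual hu hx
  simp only [opA_one_one]
  rw [mul_assoc, ENNReal.inv_mul_cancel h0 ht, mul_one]

/-- `Mult` does not ask for measurability. It is recovered by dividing the product `f g` by one `g`
in the Copson space that is positive and finite on the half line, namely `e^{-x} / U(x)`. -/
theorem mult_subset_MPlus (hu : u ∈ OmegaDual 1) {Y : Set (ℝ → ℝ≥0∞)} (hY : Y ⊆ MPlus) :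
    Mult (Cop 1 1 u 1) Y ⊆ MPlus := by
  intro f hf
  set e : ℝ → ℝ≥0∞ := fun x => (Ioi 0).indicator (fun x => ENNReal.ofReal (Real.exp (-x))) x
    with he
  have hem : Measurable e :=
    Measurable.indicator (by fun_prop) measurableSet_Ioi
  have hint : ∫⁻ x in Ioi 0, e x < ∞ := by
    have h1 : ∫⁻ x in Ioi 0, e x = ∫⁻ x in Ioi (0 : ℝ), ENNReal.ofReal (Real.exp (-x)) :=
      setLIntegral_congr_fun measurableSet_Ioi fun x hx => indicator_of_mem hx _
    rw [h1]
    have h2 : IntegrableOn (fun x : ℝ => Real.exp (-x)) (Ioi 0) := integrableOn_exp_neg_Ioi 0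
    exact h2.lintegral_lt_top
  have hX : (fun x => e x * opA 1 1 u x) ∈ Cop 1 1 u 1 :=
    ⟨div_primitive_mem_MPlus hem.aemeasurable u, by
      rw [copNorm_div_primitive hu hem.aemeasurable]; exact hint⟩
  have hfg : AEMeasurable (fun x => f x * (e x * opA 1 1 u x)) halfLine := hY (hf _ hX)
  have hm := hfg.mul (div_primitive_mem_MPlus hem.aemeasurable u).inv
  refine hm.congr ?_
  filter_upwards [ae_restrict_mem measurableSet_Ioi] with x hx
  obtain ⟨h0, ht⟩ := lintegral_Ioo_pos_of_mem_omegaDual hu hx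
  have he0 : e x ≠ 0 := by
    simp only [he, indicator_of_mem hx]
    simpa using Real.exp_pos _
  have het : e x ≠ ∞ := by
    simp only [he, indicator_of_mem hx]
    exact ENNReal.ofReal_ne_top
  simp only [Pi.mul_apply, Pi.inv_apply, opA_one_one]
  rw [mul_assoc, ENNReal.mul_inv_cancel (mul_ne_zero he0 (ENNReal.inv_ne_zero.2 ht))
    (ENNReal.mul_ne_top het (ENNReal.inv_ne_top.2 h0)), mul_one]

/-- `N` stands for the Cesàro norm of either case, and `hup` and `hlow` are the sufficiency and
necessity halves of the reduced problem. The maps `g ↦ g U` and `h ↦ h / U` carry them over to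
multipliers. -/
theorem mult_characterization (hp : 0 < p) (hq : 0 < q)
    (hu : u ∈ OmegaDual 1) (hw : w ∈ Omega (ENNReal.ofReal q)) {f : ℝ → ℝ≥0∞} (hf : f ∈ MPlus)
    {C₁ C₂ : ℝ≥0} {N : ℝ≥0∞}
    (hup : ∀ h : ℝ → ℝ≥0∞, AEMeasurable h (volume.restrict (Ioi 0)) →
      cesModular p q (powMeasure q w) (fun x => h x * (f x * (opA 1 1 u x * v x))) ≤
        (C₁ * N * ∫⁻ x in Ioi 0, h x) ^ q)
    (hlow : ∀ R : ℝ≥0∞,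
      IsL1Bound p q (powMeasure q w) (fun x => f x * (opA 1 1 u x * v x)) R →
        N ≤ C₂ * R ^ (1 / q)) :
    (f ∈ Mult (Cop 1 1 u 1) (Ces (ENNReal.ofReal p) (ENNReal.ofReal q) w v) ↔ N < ∞) ∧
    multNorm (Cop 1 1 u 1) (copNorm 1 1 u 1)
      (cesNorm (ENNReal.ofReal p) (ENNReal.ofReal q) w v) f ≤ C₁ * N ∧
    N ≤ C₂ * multNorm (Cop 1 1 u 1) (copNorm 1 1 u 1)
      (cesNorm (ENNReal.ofReal p) (ENNReal.ofReal q) w v) f := by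
  have hforw : ∀ g ∈ Cop 1 1 u 1,
      cesNorm (ENNReal.ofReal p) (ENNReal.ofReal q) w v (fun x => f x * g x) ≤
        C₁ * N * copNorm 1 1 u 1 g := by
    intro g hg
    have h1 := hup (fun t => g t * ∫⁻ x in Ioo 0 t, u x)
      (AEMeasurable.mul hg.1 (measurable_lintegral_Ioo u).aemeasurable)
    rw [← copNorm_one_eq hu hg.1] at h1
    have h2 : (fun t => (g t * ∫⁻ x in Ioo 0 t, u x) * (f t * (opA 1 1 u t * v t)))
        =ᵐ[halfLine] fun t => f t * g t * v t := by
      filter_upwards [ae_restrict_mem measurableSet_Ioi] with t ht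
      obtain ⟨h0, h0t⟩ := lintegral_Ioo_pos_of_mem_omegaDual hu ht
      rw [opA_one_one]
      calc _ = ((∫⁻ x in Ioo 0 t, u x) * (∫⁻ x in Ioo 0 t, u x)⁻¹) * (f t * g t * v t) := by ring
        _ = _ := by rw [ENNReal.mul_inv_cancel h0 h0t, one_mul]
    rw [cesModular_congr_ae _ h2] at h1
    rw [cesNorm_eq_cesModular hp hq hw]
    have h3 := ENNReal.rpow_le_rpow h1 (by positivity : 0 ≤ 1 / q)
    rwa [← ENNReal.rpow_mul, mul_one_div_cancel hq.ne', ENNReal.rpow_one] at h3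
  have hback : ∀ h : ℝ → ℝ≥0∞,
      cesModular p q (powMeasure q w) (fun x => h x * (f x * (opA 1 1 u x * v x))) =
        cesNorm (ENNReal.ofReal p) (ENNReal.ofReal q) w v
          (fun x => f x * (h x * opA 1 1 u x)) ^ q := by
    intro h
    rw [cesNorm_eq_cesModular hp hq hw, ← ENNReal.rpow_mul, one_div_mul_cancel hq.ne',
      ENNReal.rpow_one]
    congr 1
    ext x
    ring
  have hmem : ∀ h : ℝ → ℝ≥0∞, Measurable h → ∫⁻ x in Ioi 0, h x < ∞ →
      (fun x => h x * opA 1 1 u x) ∈ Cop 1 1 u 1 := fun h hm ht =>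
    ⟨div_primitive_mem_MPlus hm.aemeasurable u, by
      rwa [copNorm_div_primitive hu hm.aemeasurable]⟩
  refine ⟨⟨fun hfM => ?_, fun hN g hg => ⟨AEMeasurable.mul hf hg.1, ?_⟩⟩, ?_,
    (hlow (multNorm (Cop 1 1 u 1) (copNorm 1 1 u 1)
      (cesNorm (ENNReal.ofReal p) (ENNReal.ofReal q) w v) f ^ q) ?_).trans ?_⟩
  · obtain ⟨R, hRt, hR⟩ := exists_isL1Bound hp hq (ν := powMeasure q w)
      (F := fun x => f x * (opA 1 1 u x * v x)) fun h hm ht => by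
        rw [hback]
        exact ENNReal.rpow_lt_top_of_nonneg hq.le (hfM _ (hmem h hm ht)).2.ne
    exact (hlow R hR).trans_lt (ENNReal.mul_lt_top ENNReal.coe_lt_top
      (ENNReal.rpow_lt_top_of_nonneg (by positivity) hRt))
  · exact (hforw g hg).trans_lt
      (ENNReal.mul_lt_top (ENNReal.mul_lt_top ENNReal.coe_lt_top hN) hg.2)
  · refine iSup₂_le fun g hg => ?_
    exact ENNReal.div_le_of_le_mul (hforw g hg.1)
  · intro h hm ht
    -- The supremum in `multNorm` excludes functions vanishing almost everywhere.
    by_cases hz : h =ᵐ[halfLine] 0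
    · rw [cesModular_eq_zero hp hq _ (by filter_upwards [hz] with x hx; simp [hx])]
      exact zero_le
    have hnz : ¬ (fun x => h x * opA 1 1 u x) =ᵐ[halfLine] 0 := fun h0 => hz <| by
      filter_upwards [h0, ae_restrict_mem measurableSet_Ioi] with x hx hx0
      obtain ⟨-, h0t⟩ := lintegral_Ioo_pos_of_mem_omegaDual hu hx0
      rw [opA_one_one] at hx
      exact (mul_eq_zero.1 hx).resolve_right (ENNReal.inv_ne_zero.2 h0t)
    have hint0 : ∫⁻ x in Ioi 0, h x ≠ 0 := fun h0 => hz ((lintegral_eq_zero_iff hm).1 h0)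
    rw [hback, ← ENNReal.mul_rpow_of_nonneg _ _ hq.le]
    refine ENNReal.rpow_le_rpow ?_ hq.le
    rw [← ENNReal.div_le_iff_le_mul (Or.inl hint0) (Or.inl ht.ne),
      ← copNorm_div_primitive hu hm.aemeasurable]
    exact le_iSup₂_of_le (f := fun g _ => cesNorm (ENNReal.ofReal p) (ENNReal.ofReal q) w v
      (fun x => f x * g x) / copNorm 1 1 u 1 g) _ ⟨hmem h hm ht, hnz⟩ le_rfl
  · rw [← ENNReal.rpow_mul, mul_one_div_cancel hq.ne', ENNReal.rpow_one]

theorem aemeasurable_reduced (hv : v ∈ Weight) {f : ℝ → ℝ≥0∞} (hf : f ∈ MPlus) (u : ℝ → ℝ≥0∞) :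
    AEMeasurable (fun x => f x * (opA 1 1 u x * v x)) (volume.restrict (Ioi 0)) := by
  simp_rw [opA_one_one]
  exact AEMeasurable.mul hf ((measurable_lintegral_Ioo u).inv.aemeasurable.mul hv.1)

theorem cesNorm_top_eq (s : ℝ≥0∞) (ω f : ℝ → ℝ≥0∞) :
    cesNorm s ∞ (opAStar q q w) ω f =
      essSup (fun x => lNorm s (Ioo 0 x) (fun t => f t * ω t) *
        powMeasure q w (Ioi x) ^ (1 / q)) halfLine := by
  rw [cesNorm, wLNorm, lNorm_top]
  refine essSup_congr_ae ?_
  filter_upwards [ae_restrict_mem measurableSet_Ioi] with x hx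
  rw [opAStar, powMeasure_Ioi hx, sub_self, zero_div, ENNReal.rpow_zero, mul_one]
  rfl

/-- Since `(1 - q) q' = q`, the `q'`-th power of the outer weight is the tail to the power `q'`
times `w^q`, which is the density of `ν`. -/
theorem cesNorm_conjExp_eq (hq : 0 < q) (hq1 : q < 1) {r : ℝ≥0∞} (hw : w ∈ Omega r) (s : ℝ≥0∞)
    (ω f : ℝ → ℝ≥0∞) :
    cesNorm s (conjExp (ENNReal.ofReal q)) (opAStar q 1 w) ω f =
      (∫⁻ x, (lNorm s (Ioo 0 x) (fun t => f t * ω t) * powMeasure q w (Ioi x)) ^ (q / (1 - q))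
        ∂powMeasure q w) ^ ((1 - q) / q) := by
  have h1q : 0 < 1 - q := by linarith
  have hq' : 0 < q / (1 - q) := by positivity
  rw [cesNorm, wLNorm, conjExp_ofReal_of_lt_one hq hq1, lNorm_ofReal hq', one_div_div,
    lintegral_powMeasure hw]
  · congr 1
    refine setLIntegral_congr_fun measurableSet_Ioi fun x hx => ?_
    simp only [opAStar, wLNorm]
    rw [powMeasure_Ioi hx, ← mul_assoc, ENNReal.mul_rpow_of_nonneg _ _ hq'.le, ← ENNReal.rpow_mul,
      div_one, ENNReal.rpow_one, div_one, mul_div_cancel₀ _ h1q.ne']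
  · exact ((measurable_lNorm_Ioo _ _).mul (measurable_tail _)).pow_const _

end Weights

/-! ### Constants and the final equivalence -/

theorem exists_const_of_one_le {p q : ℝ} (hp : 0 < p) (hp1 : p ≤ 1) (hq : 1 ≤ q) :
    ∃ C₁ C₂ : ℝ≥0, ∀ v ∈ Weight, ∀ u ∈ OmegaDual 1, ∀ w ∈ Omega (ENNReal.ofReal q), ∀ f ∈ MPlus,
      (∀ h : ℝ → ℝ≥0∞, AEMeasurable h (volume.restrict (Ioi 0)) →
        cesModular p q (powMeasure q w) (fun x => h x * (f x * (opA 1 1 u x * v x))) ≤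
          (C₁ * cesNorm (conjExp (ENNReal.ofReal p)) ∞ (opAStar q q w)
            (fun x => opA 1 1 u x * v x) f * ∫⁻ x in Ioi 0, h x) ^ q) ∧
      ∀ R : ℝ≥0∞, IsL1Bound p q (powMeasure q w) (fun x => f x * (opA 1 1 u x * v x)) R →
        cesNorm (conjExp (ENNReal.ofReal p)) ∞ (opAStar q q w)
          (fun x => opA 1 1 u x * v x) f ≤ C₂ * R ^ (1 / q) := by
  have hq0 : 0 < q := by linarith
  obtain ⟨C, hC⟩ := cesModular_le_of_one_le hp hp1 hq
  refine ⟨C ^ (1 / q), 1, fun v hv u hu w hw f hf => ?_⟩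
  have hF := aemeasurable_reduced hv hf u
  have hν := isTailMeasure_powMeasure hq0 hw
  rw [cesNorm_top_eq]
  refine ⟨fun h hh => ?_, fun R hR => ?_⟩
  · refine (hC _ hν h _ hh hF _ ((withDensity_absolutelyContinuous _ _).ae_le
      (ENNReal.ae_le_essSup _))).trans (le_of_eq ?_)
    rw [mul_assoc, ENNReal.mul_rpow_of_nonneg (C ^ (1 / q) : ℝ≥0) _ hq0.le,
      ENNReal.coe_rpow_of_nonneg _ (by positivity), ← ENNReal.rpow_mul,
      one_div_mul_cancel hq0.ne', ENNReal.rpow_one]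
  · rw [ENNReal.coe_one, one_mul]
    refine essSup_le_of_ae_le _ ?_
    filter_upwards [ae_restrict_mem measurableSet_Ioi] with x hx
    exact hR.tail_mul_le hp hp1 hq0 hν hF hx

theorem exists_const_of_lt_one {p q : ℝ} (hp : 0 < p) (hp1 : p ≤ 1) (hq : 0 < q) (hq1 : q < 1) :
    ∃ C₁ C₂ : ℝ≥0, ∀ v ∈ Weight, ∀ u ∈ OmegaDual 1, ∀ w ∈ Omega (ENNReal.ofReal q), ∀ f ∈ MPlus,
      (∀ h : ℝ → ℝ≥0∞, AEMeasurable h (volume.restrict (Ioi 0)) →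
        cesModular p q (powMeasure q w) (fun x => h x * (f x * (opA 1 1 u x * v x))) ≤
          (C₁ * cesNorm (conjExp (ENNReal.ofReal p)) (conjExp (ENNReal.ofReal q)) (opAStar q 1 w)
            (fun x => opA 1 1 u x * v x) f * ∫⁻ x in Ioi 0, h x) ^ q) ∧
      ∀ R : ℝ≥0∞, IsL1Bound p q (powMeasure q w) (fun x => f x * (opA 1 1 u x * v x)) R →
        cesNorm (conjExp (ENNReal.ofReal p)) (conjExp (ENNReal.ofReal q)) (opAStar q 1 w)
          (fun x => opA 1 1 u x * v x) f ≤ C₂ * R ^ (1 / q) := by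
  have h1q : 0 < 1 - q := by linarith
  obtain ⟨C, hC⟩ := cesModular_le_of_lt_one hp hp1 hq hq1
  obtain ⟨D, hD⟩ := lintegral_conj_le_tsum hp hp1 hq hq1
  refine ⟨C ^ (1 / q), D ^ ((1 - q) / q) * (2 ^ (2 + q)) ^ (1 / q), fun v hv u hu w hw f hf => ?_⟩
  have hF := aemeasurable_reduced hv hf u
  have hν := isTailMeasure_powMeasure hq hw
  rw [cesNorm_conjExp_eq hq hq1 hw]
  refine ⟨fun h hh => (hC _ hν h _ hh hF).trans (le_of_eq ?_), fun R hR => ?_⟩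
  · rw [ENNReal.mul_rpow_of_nonneg _ _ hq.le, ENNReal.mul_rpow_of_nonneg _ _ hq.le,
      ENNReal.coe_rpow_of_nonneg _ (by positivity), ← ENNReal.rpow_mul, ← ENNReal.rpow_mul,
      one_div_mul_cancel hq.ne', ENNReal.rpow_one, div_mul_cancel₀ _ hq.ne']
  · have hcoe : ((2 ^ (2 + q) : ℝ≥0) : ℝ≥0∞) = 2 ^ (2 + q) :=
      ENNReal.coe_rpow_of_ne_zero two_ne_zero _
    have h := (hD _ hν _).trans (mul_le_mul_right (hR.tsum_le hp hp1 hq hq1 hν hF) _)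
    refine (ENNReal.rpow_le_rpow h (by positivity : 0 ≤ (1 - q) / q)).trans (le_of_eq ?_)
    rw [ENNReal.mul_rpow_of_nonneg _ _ (by positivity), ← ENNReal.rpow_mul,
      show 1 / (1 - q) * ((1 - q) / q) = 1 / q by field_simp,
      ENNReal.mul_rpow_of_nonneg _ _ (by positivity), ENNReal.coe_mul,
      ENNReal.coe_rpow_of_nonneg _ (by positivity), ENNReal.coe_rpow_of_nonneg _ (by positivity),
      hcoe, mul_assoc]

theorem mult_equivalence_of_const {p q : ℝ} (hp : 0 < p) (hq : 0 < q) {s : ℝ≥0∞}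
    {ω : (ℝ → ℝ≥0∞) → ℝ → ℝ≥0∞} {C₁ C₂ : ℝ≥0}
    (hC : ∀ v ∈ Weight, ∀ u ∈ OmegaDual 1, ∀ w ∈ Omega (ENNReal.ofReal q), ∀ f ∈ MPlus,
      (∀ h : ℝ → ℝ≥0∞, AEMeasurable h (volume.restrict (Ioi 0)) →
        cesModular p q (powMeasure q w) (fun x => h x * (f x * (opA 1 1 u x * v x))) ≤
          (C₁ * cesNorm (conjExp (ENNReal.ofReal p)) s (ω w)
            (fun x => opA 1 1 u x * v x) f * ∫⁻ x in Ioi 0, h x) ^ q) ∧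
      ∀ R : ℝ≥0∞, IsL1Bound p q (powMeasure q w) (fun x => f x * (opA 1 1 u x * v x)) R →
        cesNorm (conjExp (ENNReal.ofReal p)) s (ω w)
          (fun x => opA 1 1 u x * v x) f ≤ C₂ * R ^ (1 / q)) :
    ∃ C : ℝ≥0, 0 < C ∧
      ∀ v ∈ Weight, ∀ u ∈ OmegaDual 1, ∀ w ∈ Omega (ENNReal.ofReal q),
        Mult (Cop 1 1 u 1) (Ces (ENNReal.ofReal p) (ENNReal.ofReal q) w v) =
          Ces (conjExp (ENNReal.ofReal p)) s (ω w) (fun x => opA 1 1 u x * v x) ∧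
        ∀ f ∈ MPlus,
          multNorm (Cop 1 1 u 1) (copNorm 1 1 u 1)
              (cesNorm (ENNReal.ofReal p) (ENNReal.ofReal q) w v) f ≤
            C * cesNorm (conjExp (ENNReal.ofReal p)) s (ω w) (fun x => opA 1 1 u x * v x) f ∧
          cesNorm (conjExp (ENNReal.ofReal p)) s (ω w) (fun x => opA 1 1 u x * v x) f ≤
            C * multNorm (Cop 1 1 u 1) (copNorm 1 1 u 1)
              (cesNorm (ENNReal.ofReal p) (ENNReal.ofReal q) w v) f := by
  -- The entry `1` only guarantees that the constant is positive.
  refine ⟨max 1 (max C₁ C₂), by positivity, fun v hv u hu w hw => ⟨?_, fun f hf => ?_⟩⟩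
  · ext f
    refine ⟨fun hfM => ?_, fun hfC => ?_⟩
    · have hf := mult_subset_MPlus hu (fun _ h => h.1) hfM
      obtain ⟨hup, hlow⟩ := hC v hv u hu w hw f hf
      exact ⟨hf, (mult_characterization hp hq hu hw hf hup hlow).1.1 hfM⟩
    · obtain ⟨hup, hlow⟩ := hC v hv u hu w hw f hfC.1
      exact (mult_characterization hp hq hu hw hfC.1 hup hlow).1.2 hfC.2
  · obtain ⟨hup, hlow⟩ := hC v hv u hu w hw f hf
    obtain ⟨-, h1, h2⟩ := mult_characterization hp hq hu hw hf hup hlow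
    refine ⟨h1.trans ?_, h2.trans ?_⟩
    · gcongr
      exact (le_max_left _ _).trans (le_max_right _ _)
    · gcongr
      exact (le_max_right _ _).trans (le_max_right _ _)

end CopCes

theorem mainTheorem5 (p q : ℝ) (hp : 0 < p) (hp1 : p ≤ 1) (hq : 0 < q) (hqp : q ≠ p) :
    (1 ≤ q → ∃ C : ℝ≥0, 0 < C ∧
      ∀ v ∈ CopCes.Weight, ∀ u ∈ CopCes.OmegaDual 1, ∀ w ∈ CopCes.Omega (ENNReal.ofReal q),
        CopCes.Mult (CopCes.Cop 1 1 u 1)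
            (CopCes.Ces (ENNReal.ofReal p) (ENNReal.ofReal q) w v) =
          CopCes.Ces (CopCes.conjExp (ENNReal.ofReal p)) ∞
            (CopCes.opAStar q q w) (fun x => CopCes.opA 1 1 u x * v x) ∧
        ∀ f ∈ CopCes.MPlus,
          CopCes.multNorm (CopCes.Cop 1 1 u 1) (CopCes.copNorm 1 1 u 1)
              (CopCes.cesNorm (ENNReal.ofReal p) (ENNReal.ofReal q) w v) f ≤
            C * CopCes.cesNorm (CopCes.conjExp (ENNReal.ofReal p)) ∞
              (CopCes.opAStar q q w) (fun x => CopCes.opA 1 1 u x * v x) f ∧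
          CopCes.cesNorm (CopCes.conjExp (ENNReal.ofReal p)) ∞
              (CopCes.opAStar q q w) (fun x => CopCes.opA 1 1 u x * v x) f ≤
            C * CopCes.multNorm (CopCes.Cop 1 1 u 1) (CopCes.copNorm 1 1 u 1)
              (CopCes.cesNorm (ENNReal.ofReal p) (ENNReal.ofReal q) w v) f) ∧
    (q < 1 → ∃ C : ℝ≥0, 0 < C ∧
      ∀ v ∈ CopCes.Weight, ∀ u ∈ CopCes.OmegaDual 1, ∀ w ∈ CopCes.Omega (ENNReal.ofReal q),
        CopCes.Mult (CopCes.Cop 1 1 u 1)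
            (CopCes.Ces (ENNReal.ofReal p) (ENNReal.ofReal q) w v) =
          CopCes.Ces (CopCes.conjExp (ENNReal.ofReal p)) (CopCes.conjExp (ENNReal.ofReal q))
            (CopCes.opAStar q 1 w) (fun x => CopCes.opA 1 1 u x * v x) ∧
        ∀ f ∈ CopCes.MPlus,
          CopCes.multNorm (CopCes.Cop 1 1 u 1) (CopCes.copNorm 1 1 u 1)
              (CopCes.cesNorm (ENNReal.ofReal p) (ENNReal.ofReal q) w v) f ≤
            C * CopCes.cesNorm (CopCes.conjExp (ENNReal.ofReal p))
              (CopCes.conjExp (ENNReal.ofReal q))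
              (CopCes.opAStar q 1 w) (fun x => CopCes.opA 1 1 u x * v x) f ∧
          CopCes.cesNorm (CopCes.conjExp (ENNReal.ofReal p)) (CopCes.conjExp (ENNReal.ofReal q))
              (CopCes.opAStar q 1 w) (fun x => CopCes.opA 1 1 u x * v x) f ≤
            C * CopCes.multNorm (CopCes.Cop 1 1 u 1) (CopCes.copNorm 1 1 u 1)
              (CopCes.cesNorm (ENNReal.ofReal p) (ENNReal.ofReal q) w v) f) := by
  refine ⟨fun hq1 => ?_, fun hq1 => ?_⟩
  · obtain ⟨C₁, C₂, hC⟩ := CopCes.exists_const_of_one_le hp hp1 hq1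
    exact CopCes.mult_equivalence_of_const hp hq (ω := CopCes.opAStar q q) hC
  · obtain ⟨C₁, C₂, hC⟩ := CopCes.exists_const_of_lt_one hp hp1 hq hq1
    exact CopCes.mult_equivalence_of_const hp hq (ω := CopCes.opAStar q 1) hC
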